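/- Let $X$ be a Riemann surface and $D=\sum_{x\in X} n_x x$ an effective divisor on $X$ (a function $x\mapsto n_x\in\mathbb N$ with locally finite support). Definitions. For $x\in X$ and $n\in\mathbb N$ let $R_x^n$ be the set of $2(n+1)$-jets at $x$ of germs of holomorphic $(n+1)$-fold ramified coverings $(X,x)\to\mathbb{CP}^1$; the Möbius group $\mathrm{PSL}(2,\mathbb C)$ acts on it by postcomposition. A branching class over $(X,D)$ is an element $a=(a_x)_x\in\prod_{x\in X}\mathrm{PSL}(2,\mathbb C)\backslash R_x^{n_x}$ (the factors with $n_x=0$ are single points). A branched projective atlas on an open set $U\subset X$ is an open cover $(U_i)$ of $U$ with holomorphic, nowhere locally constant maps $f_i:U_i\to\mathbb{CP}^1$ such that on $U_i\cap U_j$ one has locally (equivalently, on each connected component) $f_i=g\circ f_j$ with $g\in\mathrm{PSL}(2,\mathbb C)$. Two atlases are equivalent if their union is an atlas, and a branched projective structure on $U$ is an equivalence class of atlases. It has branching class $a|_U$ if each of its charts is, at each point $x$ of its domain, an $(n_x+1)$-fold ramified covering whose jet lies in the orbit $a_x$; the set of such structures on $U$ is denoted $P_U^a$. Let $K_X^{\otimes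 2}(-D)$ be the sheaf of holomorphic quadratic differentials vanishing to order at least $n_x$ at each $x$. For $p_1\in P^a_{U_1}$, $p_2\in P^a_{U_2}$, an open set $W\subset U_1\cap U_2$ and $q\in H^0(W,K_X^{\otimes2}(-D))$, write $p_2-p_1=q$ on $W$ if $q=(\{\varphi_2,z\}-\{\varphi_1,z\})\,dz^{\otimes2}$ at each point of $W$ outside the support of $D$, where $z$ is a local coordinate, $\varphi_i(z)$ is a chart of $p_i$ read in an affine coordinate of $\mathbb{CP}^1$, and $\{\varphi,z\}=(\varphi''/\varphi')'-\frac12(\varphi''/\varphi')^2$; such a $q$ is unique if it exists. Proposition. Let $a$ be a branching class over $(X,D)$. (i) There is an obstruction class $c(a)\in H^1(X,K_X^{\otimes2}(-D))$ such that $c(a)=0$ if and only if $P_X^a\neq\emptyset$. More precisely, there are an open cover $(U_i)$ of $X$ and structures $p_i\in P_{U_i}^a$; and for every such cover and every such choice of $p_i$, the differences $p_j-p_i\in H^0(U_i\cap U_j,K_X^{\otimes2}(-D))$ exist and form a \v{C}ech $1$-cocycle whose class in $H^1(X,K_X^{\otimes2}(-D))$ is $c(a)$. (ii) If $P_X^a\ne\emptyset$,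 then $P_X^a$ is an affine space directed by the vector space $H^0(X,K_X^{\otimes2}(-D))$, the difference of two points being the difference $p_2-p_1$ defined above. -/

import Mathlib

open scoped Manifold ContDiff Topology MatrixGroups
open TopologicalSpace

noncomputable section

namespace BranchedProj

universe u

/-! ### Germs of holomorphic maps to the Riemann sphere

The complex projective line is `OnePoint ℂ`, on which `GL (Fin 2) ℂ` acts by Möbius
transformations; the group of Möbius transformations is the image `PGL(2, ℂ) = PSL(2, ℂ)` of this
action.  An affine coordinate of the projective line is the inverse of `w ↦ g • w`, `w : ℂ`, for
some `g : GL (Fin 2) ℂ`.  The local coordinate at a point `x` is the preferred chart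
`z = chartAt ℂ x`; none of the notions below depends on this choice. -/

section Germs

variable {X : Type u} [TopologicalSpace X] [ChartedSpace ℂ X]

/-- In the affine coordinate given by `g`, the germ of `f` at `x` is the holomorphic function
`φ(z)` of the local coordinate `z = chartAt ℂ x`. -/
def AffineRep (f : X → OnePoint ℂ) (x : X) (g : GL (Fin 2) ℂ) (φ : ℂ → ℂ) : Prop :=
  AnalyticAt ℂ φ (chartAt ℂ x x) ∧
    ∀ᶠ y in 𝓝 x, f y = g • ((φ (chartAt ℂ x y) : ℂ) : OnePoint ℂ)

/-- The map `f` to the projective line is holomorphic near `x`. -/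
def HolomorphicNear (f : X → OnePoint ℂ) (x : X) : Prop :=
  ∃ g φ, AffineRep f x g φ

/-- The germ of `f` at `x` is a holomorphic `(n+1)`-fold ramified covering with values in the
projective line. -/
def RamifiedAt (f : X → OnePoint ℂ) (x : X) (n : ℕ) : Prop :=
  ∃ g φ, AffineRep f x g φ ∧
    analyticOrderAt (fun z => φ z - φ (chartAt ℂ x x)) (chartAt ℂ x x) = ((n + 1 : ℕ) : ℕ∞)

/-- The germs at `x` of `f₁` and `f₂` have the same `k`-jet: in a common affine coordinate they
agree up to an error vanishing to order at least `k + 1` at `x`. -/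
def SameJet (k : ℕ) (x : X) (f₁ f₂ : X → OnePoint ℂ) : Prop :=
  ∃ g φ₁ φ₂, AffineRep f₁ x g φ₁ ∧ AffineRep f₂ x g φ₂ ∧
    ((k + 1 : ℕ) : ℕ∞) ≤ analyticOrderAt (φ₁ - φ₂) (chartAt ℂ x x)

lemma AffineRep.smul {f : X → OnePoint ℂ} {x : X} {g : GL (Fin 2) ℂ} {φ : ℂ → ℂ}
    (h : AffineRep f x g φ) (k : GL (Fin 2) ℂ) : AffineRep (k • f) x (k * g) φ :=
  ⟨h.1, h.2.mono fun y hy => by rw [Pi.smul_apply, hy, mul_smul]⟩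

lemma RamifiedAt.smul {f : X → OnePoint ℂ} {x : X} {n : ℕ} (h : RamifiedAt f x n)
    (k : GL (Fin 2) ℂ) : RamifiedAt (k • f) x n := by
  obtain ⟨g, φ, h1, h2⟩ := h
  exact ⟨k * g, φ, h1.smul k, h2⟩

lemma SameJet.smul {k : ℕ} {x : X} {f₁ f₂ : X → OnePoint ℂ} (h : SameJet k x f₁ f₂)
    (m : GL (Fin 2) ℂ) : SameJet k x (m • f₁) (m • f₂) := by
  obtain ⟨g, φ₁, φ₂, h1, h2, h3⟩ := h
  exact ⟨m * g, φ₁, φ₂, h1.smul m, h2.smul m, h3⟩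

lemma HolomorphicNear.sameJet_refl {f : X → OnePoint ℂ} {x : X} (h : HolomorphicNear f x)
    (k : ℕ) : SameJet k x f f := by
  obtain ⟨g, φ, h⟩ := h
  refine ⟨g, φ, φ, h, h, ?_⟩
  have : analyticOrderAt (φ - φ) (chartAt ℂ x x) = ⊤ := by
    rw [analyticOrderAt_eq_top]; simp
  rw [this]; exact le_top

lemma SameJet.symm {k : ℕ} {x : X} {f₁ f₂ : X → OnePoint ℂ} (h : SameJet k x f₁ f₂) :
    SameJet k x f₂ f₁ := by
  obtain ⟨g, φ₁, φ₂, h1, h2, h3⟩ := h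
  refine ⟨g, φ₂, φ₁, h2, h1, ?_⟩
  rwa [← neg_sub, analyticOrderAt_neg]

lemma smul_coe_of_ne {m : GL (Fin 2) ℂ} {w : ℂ} (h : m 1 0 * w + m 1 1 ≠ 0) :
    m • (w : OnePoint ℂ) = (((m 0 0 * w + m 0 1) / (m 1 0 * w + m 1 1) : ℂ) : OnePoint ℂ) := by
  rw [OnePoint.smul_some_eq_ite, if_neg h]

/-- Two affine representations of one germ differ by a Möbius transformation. -/
lemma AffineRep.eventually_smul {f : X → OnePoint ℂ} {x : X} {g g' : GL (Fin 2) ℂ} {φ φ' : ℂ → ℂ}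
    (h : AffineRep f x g φ) (h' : AffineRep f x g' φ') :
    ∀ᶠ z in 𝓝 (chartAt ℂ x x), (g'⁻¹ * g) • (φ z : OnePoint ℂ) = (φ' z : OnePoint ℂ) := by
  set e := chartAt ℂ x
  have hx : x ∈ e.source := mem_chart_source ℂ x
  have hc : Filter.Tendsto e.symm (𝓝 (e x)) (𝓝 x) := by
    have := e.symm.continuousAt (x := e x) (e.map_source hx)
    rw [ContinuousAt, e.left_inv hx] at this
    exact this
  filter_upwards [hc.eventually h.2, hc.eventually h'.2,
    e.open_target.mem_nhds (e.map_source hx)] with z h1 h2 hz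
  rw [e.right_inv hz] at h1 h2
  rw [mul_smul, ← h1, h2, inv_smul_smul]

lemma SameJet.trans {k : ℕ} {x : X} {f₁ f₂ f₃ : X → OnePoint ℂ} (h : SameJet k x f₁ f₂)
    (h' : SameJet k x f₂ f₃) : SameJet k x f₁ f₃ := by
  obtain ⟨g, φ₁, φ₂, h1, h2, h3⟩ := h
  obtain ⟨g', ψ₂, ψ₃, h4, h5, h6⟩ := h'
  have hm := h2.eventually_smul h4
  set m : GL (Fin 2) ℂ := g'⁻¹ * g with hmdef
  set p := chartAt ℂ x x with hp
  have han1 : AnalyticAt ℂ φ₁ p := h1.1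
  have han2 : AnalyticAt ℂ φ₂ p := h2.1
  have hval : φ₁ p = φ₂ p := by
    have : analyticOrderAt (φ₁ - φ₂) p ≠ 0 := by
      intro h0; rw [h0] at h3; simp at h3
    have := apply_eq_zero_of_analyticOrderAt_ne_zero this
    simpa [sub_eq_zero] using this
  have hne2 : m 1 0 * φ₂ p + m 1 1 ≠ 0 := by
    intro h0
    have := hm.self_of_nhds
    rw [OnePoint.smul_some_eq_ite, if_pos h0] at this
    exact OnePoint.infty_ne_coe _ this
  have hne1 : m 1 0 * φ₁ p + m 1 1 ≠ 0 := by rwa [hval]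
  have hd1 : AnalyticAt ℂ (fun z => m 1 0 * φ₁ z + m 1 1) p := by fun_prop
  have hd2 : AnalyticAt ℂ (fun z => m 1 0 * φ₂ z + m 1 1) p := by fun_prop
  have hev1 := hd1.continuousAt.eventually_ne hne1
  have hev2 := hd2.continuousAt.eventually_ne hne2
  let χ : ℂ → ℂ := fun z => (m 0 0 * φ₁ z + m 0 1) / (m 1 0 * φ₁ z + m 1 1)
  have hχ : AnalyticAt ℂ χ p := by
    have : AnalyticAt ℂ (fun z => m 0 0 * φ₁ z + m 0 1) p := by fun_prop
    exact this.div hd1 hne1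
  have hecont : ContinuousAt (chartAt ℂ x) x :=
    (chartAt ℂ x).continuousAt (mem_chart_source ℂ x)
  refine ⟨g', χ, ψ₃, ⟨hχ, ?_⟩, h5, ?_⟩
  · filter_upwards [h1.2, hecont.eventually hev1] with y hy1 hy2
    rw [hy1, show g = g' * m by rw [hmdef]; group, mul_smul, smul_coe_of_ne hy2]
  · have key : χ - ψ₂ =ᶠ[𝓝 p] (fun z => (m 0 0 * m 1 1 - m 0 1 * m 1 0) *
        ((m 1 0 * φ₁ z + m 1 1) * (m 1 0 * φ₂ z + m 1 1))⁻¹) * (φ₁ - φ₂) := by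
      filter_upwards [hm, hev1, hev2] with z hz hz1 hz2
      rw [smul_coe_of_ne hz2, OnePoint.coe_eq_coe] at hz
      simp only [Pi.sub_apply, Pi.mul_apply, χ, ← hz]
      rw [div_sub_div _ _ hz1 hz2, ← div_eq_mul_inv, div_mul_eq_mul_div]
      congr 1
      ring
    have hA : AnalyticAt ℂ (fun z => (m 0 0 * m 1 1 - m 0 1 * m 1 0) *
        ((m 1 0 * φ₁ z + m 1 1) * (m 1 0 * φ₂ z + m 1 1))⁻¹) p :=
      analyticAt_const.mul ((hd1.mul hd2).inv (mul_ne_zero hne1 hne2))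
    have h7 : ((k + 1 : ℕ) : ℕ∞) ≤ analyticOrderAt (χ - ψ₂) p := by
      rw [analyticOrderAt_congr key, analyticOrderAt_mul hA (han1.sub han2)]
      exact h3.trans le_add_self
    have : χ - ψ₃ = (χ - ψ₂) + (ψ₂ - ψ₃) := by abel
    rw [this]
    exact (le_min h7 h6).trans le_analyticOrderAt_add

/-- Germs at `x` of `(n+1)`-fold ramified coverings. -/
def RamGerm (x : X) (n : ℕ) : Type u := {f : X → OnePoint ℂ // RamifiedAt f x n}

instance jetSetoid (x : X) (n : ℕ) : Setoid (RamGerm x n) where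
  r f₁ f₂ := SameJet (2 * (n + 1)) x f₁.1 f₂.1
  iseqv :=
    ⟨fun f => HolomorphicNear.sameJet_refl
        (let ⟨g, φ, h, _⟩ := f.2; ⟨g, φ, h⟩) _, fun h => h.symm, fun h h' => h.trans h'⟩

/-- The set of `2(n+1)`-jets at `x` of `(n+1)`-fold ramified coverings to the projective line. -/
def RamJet (x : X) (n : ℕ) : Type u := Quotient (jetSetoid x n)

/-- Möbius transformations act on jets by postcomposition. -/
instance jetAction (x : X) (n : ℕ) : MulAction (GL (Fin 2) ℂ) (RamJet x n) where
  smul g := Quotient.map (fun f : RamGerm x n => (⟨g • f.1, f.2.smul g⟩ : RamGerm x n))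
    (fun _ _ h => SameJet.smul h g)
  one_smul j := by
    induction j using Quotient.inductionOn with
    | h f => exact congrArg (Quotient.mk _) (Subtype.ext (one_smul _ f.1))
  mul_smul g h j := by
    induction j using Quotient.inductionOn with
    | h f => exact congrArg (Quotient.mk _) (Subtype.ext (mul_smul g h f.1))

/-- Orbits of Möbius transformations on `2(n+1)`-jets of `(n+1)`-fold ramified coverings. -/
def JetOrbit (x : X) (n : ℕ) : Type u :=
  MulAction.orbitRel.Quotient (GL (Fin 2) ℂ) (RamJet x n)

/-- The orbit of the jet of a germ of ramified covering. -/
def jetOrbit {f : X → OnePoint ℂ} {x : X} {n : ℕ} (h : RamifiedAt f x n) : JetOrbit x n :=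
  (Quotient.mk (MulAction.orbitRel (GL (Fin 2) ℂ) (RamJet x n))
    (Quotient.mk (jetSetoid x n) ⟨f, h⟩))

/-- An effective divisor: a function to `ℕ` with locally finite support. -/
abbrev EffectiveDivisor (X : Type u) [TopologicalSpace X] : Type u := Function.locallyFinsupp X ℕ

/-- A branching class over `(X, D)`.  (At points outside the support of `D` the set of orbits has
one element, so that no choice is made there.) -/
def BranchingClass (D : EffectiveDivisor X) : Type u := ∀ x : X, JetOrbit x (D x)

/-! ### Branched projective structures -/

variable (X) in
/-- A chart of a branched projective atlas: a holomorphic map from an open set to the projective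
line that is nowhere locally constant.  Only the values of `toFun` on `carrier` matter. -/
structure BranchedChart where
  carrier : Opens X
  toFun : X → OnePoint ℂ
  holomorphic : ∀ x ∈ carrier, HolomorphicNear toFun x
  nonconstant : ∀ x ∈ carrier, ¬ ∀ᶠ y in 𝓝 x, toFun y = toFun x

/-- Locally on the intersection of their domains, the two charts differ by postcomposition with a
Möbius transformation (hence by one Möbius transformation on each connected component). -/
def BranchedChart.Compatible (c c' : BranchedChart X) : Prop :=
  ∀ x ∈ c.carrier, x ∈ c'.carrier → ∃ g : GL (Fin 2) ℂ, ∀ᶠ y in 𝓝 x, c.toFun y = g • c'.toFun y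

/-- Branched projective atlases on the open set `U`. -/
structure IsBranchedAtlas (U : Opens X) (A : Set (BranchedChart X)) : Prop where
  le : ∀ c ∈ A, c.carrier ≤ U
  cover : ∀ x ∈ U, ∃ c ∈ A, x ∈ c.carrier
  compatible : ∀ c ∈ A, ∀ c' ∈ A, c.Compatible c'

/-- Branched projective atlases on the open set `U`. -/
def BranchedAtlas (U : Opens X) : Type u := {A : Set (BranchedChart X) // IsBranchedAtlas U A}

lemma BranchedChart.Compatible.symm {c c' : BranchedChart X} (h : c.Compatible c') :
    c'.Compatible c := by
  intro x hx hx'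
  obtain ⟨g, hg⟩ := h x hx' hx
  exact ⟨g⁻¹, hg.mono fun y hy => by rw [hy, inv_smul_smul]⟩

/-- Two atlases are equivalent if their union is an atlas. -/
instance atlasSetoid (U : Opens X) : Setoid (BranchedAtlas U) where
  r A B := IsBranchedAtlas U (A.1 ∪ B.1)
  iseqv := by
    refine ⟨fun A => by rw [Set.union_self]; exact A.2,
      fun {A B} h => by rw [Set.union_comm]; exact h, fun {A B C} h h' => ?_⟩
    have key : ∀ c ∈ A.1, ∀ c' ∈ C.1, c.Compatible c' := by
      intro c hc c' hc' x hx hx'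
      obtain ⟨d, hd, hxd⟩ := B.2.cover x (A.2.le c hc hx)
      obtain ⟨g, hg⟩ := h.compatible c (Or.inl hc) d (Or.inr hd) x hx hxd
      obtain ⟨g', hg'⟩ := h'.compatible d (Or.inl hd) c' (Or.inr hc') x hxd hx'
      refine ⟨g * g', ?_⟩
      filter_upwards [hg, hg'] with y h1 h2
      rw [h1, h2, mul_smul]
    refine ⟨?_, ?_, ?_⟩
    · rintro c (hc | hc)
      exacts [A.2.le c hc, C.2.le c hc]
    · intro x hx
      obtain ⟨c, hc, hxc⟩ := A.2.cover x hx
      exact ⟨c, Or.inl hc, hxc⟩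
    · rintro c (hc | hc) c' (hc' | hc')
      exacts [A.2.compatible c hc c' hc', key c hc c' hc', (key c' hc' c hc).symm,
        C.2.compatible c hc c' hc']

/-- Branched projective structures on the open set `U`. -/
def BranchedStructure (U : Opens X) : Type u := Quotient (atlasSetoid U)

/-- `c` belongs to some atlas of the structure `p`. -/
def BranchedStructure.IsChart {U : Opens X} (p : BranchedStructure U) (c : BranchedChart X) :
    Prop :=
  ∃ A : BranchedAtlas U, Quotient.mk (atlasSetoid U) A = p ∧ c ∈ A.1

/-- `p` has branching divisor `D|_U` and branching class `a|_U`. -/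
def BranchedStructure.HasClass {U : Opens X} (p : BranchedStructure U) {D : EffectiveDivisor X}
    (a : BranchingClass D) : Prop :=
  ∀ c, p.IsChart c → ∀ x ∈ c.carrier, ∃ h : RamifiedAt c.toFun x (D x), jetOrbit h = a x

/-- The set of branched projective structures on `U` with branching class `a|_U`. -/
def StructuresWithClass {D : EffectiveDivisor X} (a : BranchingClass D) (U : Opens X) : Type u :=
  {p : BranchedStructure U // p.HasClass a}

/-! ### Quadratic differentials vanishing over a divisor -/

/-- Sections over `U` of the line bundle of quadratic differentials (bilinear forms on the tangent
lines), without any regularity. -/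
abbrev RoughQuadDiff (U : Opens X) : Type u :=
  ∀ x : U, TangentSpace 𝓘(ℂ, ℂ) (x : X) →ₗ[ℂ] TangentSpace 𝓘(ℂ, ℂ) (x : X) →ₗ[ℂ] ℂ

open Classical in
/-- The coefficient `u(z)` of `q = u(z) dz²` in the coordinate `z = e`, that is, the value of `q`
on the coordinate vector field `∂/∂z` (and zero outside the image of `U`). -/
def coeff {U : Opens X} (q : RoughQuadDiff U) (e : OpenPartialHomeomorph X ℂ) (z : ℂ) : ℂ :=
  if h : e.symm z ∈ U then
    q ⟨e.symm z, h⟩ (mfderiv 𝓘(ℂ, ℂ) 𝓘(ℂ, ℂ) e.symm z (1 : ℂ))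
      (mfderiv 𝓘(ℂ, ℂ) 𝓘(ℂ, ℂ) e.symm z (1 : ℂ))
  else 0

lemma coeff_add {U : Opens X} (q r : RoughQuadDiff U) (e : OpenPartialHomeomorph X ℂ) :
    coeff (q + r) e = coeff q e + coeff r e := by
  funext z
  simp only [coeff, Pi.add_apply]
  split_ifs <;> simp

lemma coeff_smul {U : Opens X} (c : ℂ) (q : RoughQuadDiff U) (e : OpenPartialHomeomorph X ℂ) :
    coeff (c • q) e = (fun _ => c) * coeff q e := by
  funext z
  simp only [coeff, Pi.smul_apply, Pi.mul_apply]
  split_ifs <;> simp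

/-- The vector space of sections over `U` of `K_X^{⊗2}(-D)`: holomorphic quadratic differentials
on `U` vanishing to order at least `D x` at each point `x`. -/
def QuadDiff (D : EffectiveDivisor X) (U : Opens X) : Submodule ℂ (RoughQuadDiff U) where
  carrier := {q | ∀ x ∈ U, AnalyticAt ℂ (coeff q (chartAt ℂ x)) (chartAt ℂ x x) ∧
    (D x : ℕ∞) ≤ analyticOrderAt (coeff q (chartAt ℂ x)) (chartAt ℂ x x)}
  zero_mem' := by
    intro x _
    have : coeff (0 : RoughQuadDiff U) (chartAt ℂ x) = 0 := by
      funext z; simp [coeff]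
    rw [this]
    refine ⟨analyticAt_const, ?_⟩
    rw [analyticOrderAt_eq_top.2 (by simp)]
    exact le_top
  add_mem' := by
    intro q r hq hr x hx
    rw [coeff_add]
    exact ⟨(hq x hx).1.add (hr x hx).1,
      (le_min (hq x hx).2 (hr x hx).2).trans le_analyticOrderAt_add⟩
  smul_mem' := by
    intro c q hq x hx
    rw [coeff_smul]
    refine ⟨analyticAt_const.mul (hq x hx).1, ?_⟩
    rw [analyticOrderAt_mul analyticAt_const (hq x hx).1]
    exact (hq x hx).2.trans le_add_self

lemma coeff_res_eventuallyEq {U V : Opens X} (h : V ≤ U) (q : RoughQuadDiff U) {x : X}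
    (hx : x ∈ V) :
    coeff (fun y : V => q ⟨y, h y.2⟩) (chartAt ℂ x) =ᶠ[𝓝 (chartAt ℂ x x)]
      coeff q (chartAt ℂ x) := by
  have hs : x ∈ (chartAt ℂ x).source := mem_chart_source ℂ x
  have hc := (chartAt ℂ x).symm.continuousAt (x := chartAt ℂ x x) ((chartAt ℂ x).map_source hs)
  have hV : ∀ᶠ z in 𝓝 (chartAt ℂ x x), (chartAt ℂ x).symm z ∈ V := by
    apply hc.eventually
    rw [(chartAt ℂ x).left_inv hs]
    exact V.isOpen.mem_nhds hx
  filter_upwards [hV] with z hz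
  simp only [coeff, dif_pos hz, dif_pos (h hz)]

/-- Restriction of sections of `K_X^{⊗2}(-D)`. -/
def QuadDiff.res (D : EffectiveDivisor X) {U V : Opens X} (h : V ≤ U) :
    QuadDiff D U →ₗ[ℂ] QuadDiff D V where
  toFun q := ⟨fun y => q.1 ⟨y, h y.2⟩, fun x hx => by
    have he := coeff_res_eventuallyEq h q.1 hx
    refine ⟨(q.2 x (h hx)).1.congr he.symm, ?_⟩
    rw [analyticOrderAt_congr he]
    exact (q.2 x (h hx)).2⟩
  map_add' _ _ := rfl
  map_smul' _ _ := rfl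

/-! ### Čech cohomology in degree one

The open covers used are those of the form `(U_x)_{x ∈ X}` with `x ∈ U_x`.  Every open cover
`(V_i)` is refined by such a cover, namely `U_x = V_{i(x)}` for any choice of `i(x)` with
`x ∈ V_{i(x)}`, and the direct limit over these covers is the usual first cohomology group. -/

variable (X) in
/-- Open covers indexed by the points, with `x` in the member of index `x`. -/
structure PointedCover where
  nhd : X → Opens X
  mem : ∀ x, x ∈ nhd x

/-- `𝒰 ≤ 𝒱` if `𝒱` refines `𝒰`. -/
instance : Preorder (PointedCover X) where
  le 𝒰 𝒱 := ∀ x, 𝒱.nhd x ≤ 𝒰.nhd x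
  le_refl _ _ := le_rfl
  le_trans _ _ _ h h' x := (h' x).trans (h x)

instance : DecidableEq (PointedCover X) := Classical.decEq _

instance : Nonempty (PointedCover X) := ⟨⟨fun _ => ⊤, fun _ => trivial⟩⟩

instance : IsDirectedOrder (PointedCover X) :=
  ⟨fun 𝒰 𝒱 => ⟨⟨fun x => 𝒰.nhd x ⊓ 𝒱.nhd x, fun x => ⟨𝒰.mem x, 𝒱.mem x⟩⟩,
    fun _ => inf_le_left, fun _ => inf_le_right⟩⟩

/-- Čech `1`-cochains `(c_{xy})` of the cover `𝒰` with values in `K_X^{⊗2}(-D)`. -/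
def Cochain (D : EffectiveDivisor X) (𝒰 : PointedCover X) : Type u :=
  ∀ x y : X, QuadDiff D (𝒰.nhd x ⊓ 𝒰.nhd y)

instance (D : EffectiveDivisor X) (𝒰 : PointedCover X) : AddCommGroup (Cochain D 𝒰) :=
  inferInstanceAs (AddCommGroup (∀ x y : X, QuadDiff D (𝒰.nhd x ⊓ 𝒰.nhd y)))

instance (D : EffectiveDivisor X) (𝒰 : PointedCover X) : Module ℂ (Cochain D 𝒰) :=
  inferInstanceAs (Module ℂ (∀ x y : X, QuadDiff D (𝒰.nhd x ⊓ 𝒰.nhd y)))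

/-- Čech `1`-cocycles `(c_{xy})` of the cover `𝒰` with values in `K_X^{⊗2}(-D)`:
`c_{xy} + c_{yz} = c_{xz}` on triple intersections. -/
def Cocycle (D : EffectiveDivisor X) (𝒰 : PointedCover X) :
    Submodule ℂ (Cochain D 𝒰) where
  carrier := {c | ∀ x y z : X,
    QuadDiff.res D (V := 𝒰.nhd x ⊓ 𝒰.nhd y ⊓ 𝒰.nhd z) inf_le_left (c x y) +
      QuadDiff.res D (V := 𝒰.nhd x ⊓ 𝒰.nhd y ⊓ 𝒰.nhd z)
        (le_inf (inf_le_left.trans inf_le_right) inf_le_right) (c y z) =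
      QuadDiff.res D (V := 𝒰.nhd x ⊓ 𝒰.nhd y ⊓ 𝒰.nhd z)
        (le_inf (inf_le_left.trans inf_le_left) inf_le_right) (c x z)}
  zero_mem' := by
    intro x y z
    apply Subtype.ext
    funext w
    exact add_zero _
  add_mem' := by
    intro c d hc hd x y z
    have h := congrArg₂ (· + ·) (hc x y z) (hd x y z)
    rw [add_add_add_comm] at h
    exact h
  smul_mem' := by
    intro k c hc x y z
    have h := congrArg (k • ·) (hc x y z)
    rw [smul_add] at h
    exact h

/-- The coboundary `(t_x) ↦ (t_y - t_x)`. -/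
def coboundary (D : EffectiveDivisor X) (𝒰 : PointedCover X) :
    (∀ x : X, QuadDiff D (𝒰.nhd x)) →ₗ[ℂ] Cocycle D 𝒰 where
  toFun t := ⟨fun x y => QuadDiff.res D inf_le_right (t y) - QuadDiff.res D inf_le_left (t x), by
    intro x y z
    apply Subtype.ext
    funext w
    exact sub_add_sub_cancel' (G := TangentSpace 𝓘(ℂ, ℂ) (w : X) →ₗ[ℂ]
      TangentSpace 𝓘(ℂ, ℂ) (w : X) →ₗ[ℂ] ℂ) _ _ _⟩
  map_add' s t := by
    apply Subtype.ext
    funext x y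
    exact add_sub_add_comm (QuadDiff.res D inf_le_right (s y)) (QuadDiff.res D inf_le_right (t y))
      (QuadDiff.res D inf_le_left (s x)) (QuadDiff.res D inf_le_left (t x))
  map_smul' k t := by
    apply Subtype.ext
    funext x y
    exact (smul_sub k (QuadDiff.res D inf_le_right (t y)) (QuadDiff.res D inf_le_left (t x))).symm

/-- The first Čech cohomology of the cover `𝒰`. -/
abbrev CoverH1 (D : EffectiveDivisor X) (𝒰 : PointedCover X) : Type u :=
  Cocycle D 𝒰 ⧸ LinearMap.range (coboundary D 𝒰)

/-- Restriction of cocycles to a finer cover. -/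
def Cocycle.refine (D : EffectiveDivisor X) {𝒰 𝒱 : PointedCover X} (h : 𝒰 ≤ 𝒱) :
    Cocycle D 𝒰 →ₗ[ℂ] Cocycle D 𝒱 where
  toFun c := ⟨fun x y => QuadDiff.res D (inf_le_inf (h x) (h y)) (c.1 x y), by
    intro x y z
    apply Subtype.ext
    funext w
    have := congrArg (fun q => q.1 ⟨w.1, ⟨⟨h x w.2.1.1, h y w.2.1.2⟩, h z w.2.2⟩⟩) (c.2 x y z)
    exact this⟩
  map_add' _ _ := rfl
  map_smul' _ _ := rfl

/-- The map on cohomology of covers given by refinement. -/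
def CoverH1.refine (D : EffectiveDivisor X) (𝒰 𝒱 : PointedCover X) (h : 𝒰 ≤ 𝒱) :
    CoverH1 D 𝒰 →ₗ[ℂ] CoverH1 D 𝒱 :=
  Submodule.mapQ _ _ (Cocycle.refine D h) (by
    rintro _ ⟨t, rfl⟩
    exact ⟨fun x => QuadDiff.res D (h x) (t x), rfl⟩)

instance (D : EffectiveDivisor X) :
    DirectedSystem (CoverH1 D) (fun 𝒰 𝒱 h => CoverH1.refine D 𝒰 𝒱 h) where
  map_self _ c := by
    induction c using Submodule.Quotient.induction_on with
    | H c => rfl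
  map_map _ _ _ _ _ c := by
    induction c using Submodule.Quotient.induction_on with
    | H c => rfl

/-- The cohomology space `H¹(X, K_X^{⊗2}(-D))`. -/
def H1 (D : EffectiveDivisor X) : Type u :=
  Module.DirectLimit (CoverH1 D) (CoverH1.refine D)

instance (D : EffectiveDivisor X) : AddCommGroup (H1 D) :=
  inferInstanceAs (AddCommGroup (Module.DirectLimit (CoverH1 D) (CoverH1.refine D)))

instance (D : EffectiveDivisor X) : Module ℂ (H1 D) :=
  inferInstanceAs (Module ℂ (Module.DirectLimit (CoverH1 D) (CoverH1.refine D)))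

/-- The cohomology class of a cocycle. -/
def Cocycle.toH1 (D : EffectiveDivisor X) (𝒰 : PointedCover X) : Cocycle D 𝒰 →ₗ[ℂ] H1 D :=
  (Module.DirectLimit.of ℂ (PointedCover X) (CoverH1 D) (CoverH1.refine D) 𝒰).comp
    (Submodule.mkQ _)

/-- The space of global sections `H⁰(X, K_X^{⊗2}(-D))`. -/
abbrev H0 (D : EffectiveDivisor X) : Type u := QuadDiff D (⊤ : Opens X)

/-! ### Differences of branched projective structures -/

/-- The Schwarzian derivative `(φ''/φ')' - (φ''/φ')² / 2`. -/
def schwarzian (φ : ℂ → ℂ) (z : ℂ) : ℂ :=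
  deriv (fun w => deriv (deriv φ) w / deriv φ w) z - (deriv (deriv φ) z / deriv φ z) ^ 2 / 2

/-- The equality `p₂|_W - p₁|_W = q` for branched projective structures `p₁`, `p₂` with branching
divisor `D` and a quadratic differential `q` on `W`: if `φ₁(z)`, `φ₂(z)` are charts of `p₁`, `p₂`
at `x` read in affine coordinates of the projective line, then `q = ({φ₂, z} - {φ₁, z}) dz²` at
`x`.  It is enough to require this at the points `x` where the charts are unramified, since these
are dense and `q` is continuous. -/
def IsDifference {D : EffectiveDivisor X} {a : BranchingClass D} {U₁ U₂ : Opens X}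
    (p₁ : StructuresWithClass a U₁) (p₂ : StructuresWithClass a U₂)
    {W : Opens X} (q : QuadDiff D W) : Prop :=
  W ≤ U₁ ∧ W ≤ U₂ ∧ ∀ x ∈ W, D x = 0 → ∀ c₁ c₂, p₁.1.IsChart c₁ → p₂.1.IsChart c₂ →
    x ∈ c₁.carrier → x ∈ c₂.carrier → ∀ g₁ φ₁ g₂ φ₂,
    AffineRep c₁.toFun x g₁ φ₁ → AffineRep c₂.toFun x g₂ φ₂ →
    coeff q.1 (chartAt ℂ x) (chartAt ℂ x x) =
      schwarzian φ₂ (chartAt ℂ x x) - schwarzian φ₁ (chartAt ℂ x x)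

end Germs

end BranchedProj

end

open BranchedProj

/-! Everything rests on a local computation. Let φ₁ be (n+1)-fold ramified at p, so that φ₁'
vanishes there to order n, and let φ₂ have the same 2(n+1)-jet. Then φ₂' - φ₁' vanishes to order
2n+2, hence φ₂' = u φ₁' with u - 1 of order at least n+2, and this leaves room for a second
division: u' = l φ₁' u with l holomorphic and l(p) = 0 (`exists_multiplier`). In terms of l, the
difference of the Schwarzian derivatives is φ₁' (l' - φ₁' l²/2) (`Multiplier.schwarzian_sub`), which
is holomorphic and vanishes to order at least n.

Conversely, if Q = r φ₁' is prescribed, then l' - φ₁' l²/2 = r is a Riccati equation with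
holomorphic coefficients, even at a ramification point. Put l = -2γ/v: it follows from the linear
system v' = φ₁' γ, γ' = -(r/2) v, which is solved by a convergent series (`exists_linear_system`).
Integrating u φ₁' with u = v⁻² gives φ₂, with the right jet (`exists_prescribed_schwarzianDiff`).
For Q = 0 the initial value l(p) = 0 forces l = 0, and φ₂ = φ₁ once u(p) = 1 and the values at p
agree (`eventually_eq_of_schwarzianDiff_eq_zero`).

Off the support of D all unramified germs lie in one orbit (`jetOrbit_zero_eq`), so the branching
class only constrains a discrete set of points. Hence local structures exist
(`exists_local_structure`), differences exist and are unique (`exists_isDifference`,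
`IsDifference.unique`), a zero difference means equality (`IsDifference.eq`), and translations exist
(`exists_translate`): the structures form a torsor sheaf under K²(-D). The rest is the usual
formalism: the class of the torsor in H¹ vanishes exactly when there is a global section, and then
the global sections form an H⁰-torsor. -/

namespace BranchedProj

/-! ### Linear holomorphic systems in one variable. -/

section Analysis

open Metric

lemma exists_primitive_ball (c : ℂ) (r : ℝ) (f : ℂ → ℂ) (hf : DifferentiableOn ℂ f (ball c r)) :
    ∃ F : ℂ → ℂ, F c = 0 ∧ ∀ z ∈ ball c r, HasDerivAt F (f z) z := by
  obtain ⟨F, h1, h2⟩ := hf.isExactOn_ball.with_val_at c 0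
  exact ⟨F, h1, h2⟩

lemma norm_primitive_le {c : ℂ} {r C : ℝ} {f F : ℂ → ℂ} (hF : F c = 0)
    (hd : ∀ z ∈ ball c r, HasDerivAt F (f z) z) (hC : ∀ z ∈ ball c r, ‖f z‖ ≤ C) :
    ∀ z ∈ ball c r, ‖F z‖ ≤ C * r := by
  intro z hz
  have hr : 0 < r := pos_of_mem_ball hz
  have hc : c ∈ ball c r := mem_ball_self hr
  have h := (convex_ball c r).norm_image_sub_le_of_norm_hasDerivWithin_le
    (fun w hw => (hd w hw).hasDerivWithinAt) hC hc hz
  rw [hF, sub_zero] at h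
  have hC0 : 0 ≤ C := (norm_nonneg _).trans (hC c hc)
  exact h.trans (mul_le_mul_of_nonneg_left (mem_ball_iff_norm.1 hz).le hC0)

/-- A linear holomorphic system `v' = A γ`, `γ' = B v` has a local solution with `v p = 1` and
`γ p = 0`. -/
lemma exists_linear_system {A B : ℂ → ℂ} {p : ℂ} (hA : AnalyticAt ℂ A p) (hB : AnalyticAt ℂ B p) :
    ∃ v γ : ℂ → ℂ, AnalyticAt ℂ v p ∧ AnalyticAt ℂ γ p ∧ v p = 1 ∧ γ p = 0 ∧
      ∀ᶠ z in 𝓝 p, HasDerivAt v (A z * γ z) z ∧ HasDerivAt γ (B z * v z) z := by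
  obtain ⟨M, hM⟩ : ∃ M : ℝ, M = ‖A p‖ + ‖B p‖ + 1 := ⟨_, rfl⟩
  have hMpos : 0 < M := by rw [hM]; positivity
  have ev : ∀ᶠ z in 𝓝 p, (AnalyticAt ℂ A z ∧ AnalyticAt ℂ B z) ∧ ‖A z‖ < M ∧ ‖B z‖ < M := by
    refine (hA.eventually_analyticAt.and hB.eventually_analyticAt).and
      ((hA.continuousAt.norm.eventually_lt_const ?_).and
        (hB.continuousAt.norm.eventually_lt_const ?_))
    · rw [hM]; linarith [norm_nonneg (B p)]
    · rw [hM]; linarith [norm_nonneg (A p)]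
  obtain ⟨r₀, hr₀, hball⟩ := Metric.eventually_nhds_iff_ball.1 ev
  -- With M r ≤ 1/2, multiplying by `A` or `B` and then integrating from p halves the sup bound on
  -- the ball.
  obtain ⟨r, hr⟩ : ∃ r : ℝ, r = min r₀ (1 / (2 * M)) := ⟨_, rfl⟩
  have hrpos : 0 < r := by rw [hr]; positivity
  have hMr : M * r ≤ 1 / 2 := by
    have : r ≤ 1 / (2 * M) := hr ▸ min_le_right _ _
    calc M * r ≤ M * (1 / (2 * M)) := by gcongr
      _ = 1 / 2 := by field_simp
  have hsub : ball p r ⊆ ball p r₀ := ball_subset_ball (hr ▸ min_le_left _ _)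
  have hAd : DifferentiableOn ℂ A (ball p r) := fun z hz =>
    (hball z (hsub hz)).1.1.differentiableAt.differentiableWithinAt
  have hBd : DifferentiableOn ℂ B (ball p r) := fun z hz =>
    (hball z (hsub hz)).1.2.differentiableAt.differentiableWithinAt
  have hAM : ∀ z ∈ ball p r, ‖A z‖ ≤ M := fun z hz => (hball z (hsub hz)).2.1.le
  have hBM : ∀ z ∈ ball p r, ‖B z‖ ≤ M := fun z hz => (hball z (hsub hz)).2.2.le
  -- Primitives are chosen for every function, with no condition on the non-holomorphic ones, so
  -- that integration is an operator that can be iterated.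
  have hprim : ∀ f : ℂ → ℂ, ∃ F : ℂ → ℂ, DifferentiableOn ℂ f (ball p r) →
      F p = 0 ∧ ∀ z ∈ ball p r, HasDerivAt F (f z) z := by
    intro f
    by_cases hf : DifferentiableOn ℂ f (ball p r)
    · obtain ⟨F, hF⟩ := exists_primitive_ball p r f hf
      exact ⟨F, fun _ => hF⟩
    · exact ⟨0, fun h => absurd h hf⟩
  choose I hI using hprim
  have hId : ∀ f, DifferentiableOn ℂ f (ball p r) → DifferentiableOn ℂ (I f) (ball p r) :=
    fun f hf z hz => ((hI f hf).2 z hz).differentiableAt.differentiableWithinAt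
  have bound : ∀ (G f : ℂ → ℂ) (C : ℝ), DifferentiableOn ℂ G (ball p r) →
      (∀ z ∈ ball p r, ‖G z‖ ≤ M) → DifferentiableOn ℂ f (ball p r) →
      (∀ z ∈ ball p r, ‖f z‖ ≤ C) → ∀ z ∈ ball p r, ‖I (G * f) z‖ ≤ C * (1 / 2) := by
    intro G f C hG hGM hf hfC z hz
    have hC0 : 0 ≤ C := (norm_nonneg _).trans (hfC z hz)
    have := norm_primitive_le (hI _ (hG.mul hf)).1 (hI _ (hG.mul hf)).2 (C := M * C)
      (fun w hw => by
        rw [Pi.mul_apply, norm_mul]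
        exact mul_le_mul (hGM w hw) (hfC w hw) (norm_nonneg _) hMpos.le) z hz
    calc _ ≤ M * C * r := this
      _ = C * (M * r) := by ring
      _ ≤ C * (1 / 2) := by gcongr
  -- Terms of the Picard series for v, starting from the constant 1. Each costs two integrations,
  -- hence the ratio 1/4.
  let v : ℕ → ℂ → ℂ := fun k => (fun f => I (A * I (B * f)))^[k] 1
  let γ : ℕ → ℂ → ℂ := fun k => I (B * v k)
  have hvs : ∀ k, v (k + 1) = I (A * γ k) := fun k => Function.iterate_succ_apply' _ _ _
  have hv : ∀ k, DifferentiableOn ℂ (v k) (ball p r) ∧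
      ∀ z ∈ ball p r, ‖v k z‖ ≤ (1 / 4 : ℝ) ^ k := by
    intro k
    induction k with
    | zero =>
      refine ⟨differentiableOn_const _, fun z _ => ?_⟩
      simp [v]
    | succ k ih =>
      have hγd := hId _ (hBd.mul ih.1)
      have hγb := bound B (v k) _ hBd hBM ih.1 ih.2
      rw [hvs]
      refine ⟨hId _ (hAd.mul hγd), fun z hz => ?_⟩
      refine (bound A _ _ hAd hAM hγd hγb z hz).trans (le_of_eq ?_)
      ring
  have hγ : ∀ k, DifferentiableOn ℂ (γ k) (ball p r) ∧
      ∀ z ∈ ball p r, ‖γ k z‖ ≤ (1 / 4 : ℝ) ^ k * (1 / 2) := fun k =>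
    ⟨hId _ (hBd.mul (hv k).1), bound B _ _ hBd hBM (hv k).1 (hv k).2⟩
  have hs1 : Summable fun k : ℕ => (1 / 4 : ℝ) ^ k :=
    summable_geometric_of_lt_one (by norm_num) (by norm_num)
  have hs2 := hs1.mul_right (1 / 2)
  have hvD := Complex.differentiableOn_tsum_of_summable_norm hs1 (fun k => (hv k).1) isOpen_ball
    (fun k z hz => (hv k).2 z hz)
  have hγD := Complex.differentiableOn_tsum_of_summable_norm hs2 (fun k => (hγ k).1) isOpen_ball
    (fun k z hz => (hγ k).2 z hz)
  have hp : p ∈ ball p r := mem_ball_self hrpos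
  have hvd0 : ∀ z, deriv (v 0) z = 0 := fun z => by
    show deriv (fun _ => (1 : ℂ)) z = 0
    simp
  refine ⟨fun z => ∑' k, v k z, fun z => ∑' k, γ k z, hvD.analyticAt (isOpen_ball.mem_nhds hp),
    hγD.analyticAt (isOpen_ball.mem_nhds hp), ?_, ?_, ?_⟩
  · show ∑' k, v k p = 1
    rw [tsum_eq_single 0]
    · rfl
    · intro k hk
      obtain ⟨k, rfl⟩ := Nat.exists_eq_succ_of_ne_zero hk
      rw [Nat.succ_eq_add_one, hvs]
      exact (hI _ (hAd.mul (hγ k).1)).1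
  · have : ∀ k, γ k p = 0 := fun k => (hI _ (hBd.mul (hv k).1)).1
    simp [this]
  · filter_upwards [isOpen_ball.mem_nhds hp] with z hz
    have hsγ : HasSum (fun k => γ k z) (∑' k, γ k z) :=
      (Summable.of_norm_bounded hs2 fun k => (hγ k).2 z hz).hasSum
    have hsv : HasSum (fun k => v k z) (∑' k, v k z) :=
      (Summable.of_norm_bounded hs1 fun k => (hv k).2 z hz).hasSum
    have h1 := Complex.hasSum_deriv_of_summable_norm hs1 (fun k => (hv k).1) isOpen_ball
      (fun k z hz => (hv k).2 z hz) hz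
    have h2 := Complex.hasSum_deriv_of_summable_norm hs2 (fun k => (hγ k).1) isOpen_ball
      (fun k z hz => (hγ k).2 z hz) hz
    have e1 : deriv (fun z => ∑' k, v k z) z = A z * ∑' k, γ k z := by
      refine h1.unique ?_
      rw [← hasSum_nat_add_iff' 1]
      -- The derivative of the constant term drops out, and the remaining terms are those of A γ
      -- after a shift of index.
      simp only [Finset.range_one, Finset.sum_singleton, hvd0, sub_zero]
      suffices e : (fun k => deriv (v (k + 1)) z) = fun k => A z * γ k z by
        rw [e]; exact hsγ.mul_left (A z)
      funext k
      rw [hvs]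
      exact ((hI _ (hAd.mul (hγ k).1)).2 z hz).deriv
    have e2 : deriv (fun z => ∑' k, γ k z) z = B z * ∑' k, v k z := by
      refine h2.unique ?_
      suffices e : (fun k => deriv (γ k) z) = fun k => B z * v k z by
        rw [e]; exact hsv.mul_left (B z)
      funext k
      exact ((hI _ (hBd.mul (hv k).1)).2 z hz).deriv
    have d1 := (hvD.differentiableAt (isOpen_ball.mem_nhds hz)).hasDerivAt
    have d2 := (hγD.differentiableAt (isOpen_ball.mem_nhds hz)).hasDerivAt
    rw [e1] at d1
    rw [e2] at d2
    exact ⟨d1, d2⟩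

end Analysis

/-! ### Schwarzian derivatives of ramified germs in a coordinate. -/

section NormalForms

/-- Factor the powers of z - p out of both functions and divide the remaining factors; the excess
order k passes to the quotient. This makes division by φ₁' possible at a ramification point. -/
lemma exists_eq_mul_of_order_le {f g : ℂ → ℂ} {p : ℂ} {n k : ℕ} (hf : AnalyticAt ℂ f p)
    (hg : AnalyticAt ℂ g p) (hgn : analyticOrderAt g p = n)
    (hfn : ((n + k : ℕ) : ℕ∞) ≤ analyticOrderAt f p) :
    ∃ h : ℂ → ℂ, AnalyticAt ℂ h p ∧ (k : ℕ∞) ≤ analyticOrderAt h p ∧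
      ∀ᶠ z in 𝓝 p, f z = h z * g z := by
  obtain ⟨F, hF, hfF⟩ := (natCast_le_analyticOrderAt hf).1 hfn
  obtain ⟨G, hG, hG0, hgG⟩ := hg.analyticOrderAt_eq_natCast.1 hgn
  have hh : AnalyticAt ℂ (fun z => (z - p) ^ k * (F z / G z)) p := by
    have := hF.div hG hG0
    fun_prop
  refine ⟨_, hh, (natCast_le_analyticOrderAt hh).2
    ⟨fun z => F z / G z, hF.div hG hG0, .of_forall fun _ => rfl⟩, ?_⟩
  filter_upwards [hfF, hgG, hG.continuousAt.eventually_ne hG0] with z h1 h2 h3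
  rw [h1, h2, smul_eq_mul, smul_eq_mul, pow_add]
  field_simp

lemma eventually_of_punctured {f g : ℂ → ℂ} {p : ℂ} (hf : AnalyticAt ℂ f p) (hg : AnalyticAt ℂ g p)
    (h : ∀ᶠ z in 𝓝[≠] p, f z = g z) : ∀ᶠ z in 𝓝 p, f z = g z :=
  (hf.frequently_eq_iff_eventually_eq hg).1 h.frequently

lemma eventually_eq_const_of_deriv {f : ℂ → ℂ} {p : ℂ} (hf : AnalyticAt ℂ f p)
    (h : ∀ᶠ z in 𝓝 p, deriv f z = 0) : ∀ᶠ z in 𝓝 p, f z = f p := by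
  have h1 := hf.analyticOrderAt_deriv_add_one
  rw [analyticOrderAt_eq_top.2 h, top_add] at h1
  exact (analyticOrderAt_eq_top.1 h1.symm).mono fun z hz => sub_eq_zero.1 hz

lemma analyticOrderAt_deriv_of_sub {φ : ℂ → ℂ} {p : ℂ} {n : ℕ} (hφ : AnalyticAt ℂ φ p)
    (hn : analyticOrderAt (fun z => φ z - φ p) p = ((n + 1 : ℕ) : ℕ∞)) :
    analyticOrderAt (deriv φ) p = n := by
  have h := hφ.analyticOrderAt_deriv_add_one
  rw [hn, Nat.cast_add, Nat.cast_one] at h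
  exact WithTop.add_right_cancel ENat.one_ne_top h

lemma eventually_deriv_ne_zero {φ : ℂ → ℂ} {p : ℂ} {n : ℕ} (hφ : AnalyticAt ℂ φ p)
    (hn : analyticOrderAt (fun z => φ z - φ p) p = ((n + 1 : ℕ) : ℕ∞)) :
    ∀ᶠ z in 𝓝[≠] p, deriv φ z ≠ 0 := by
  have h := analyticOrderAt_deriv_of_sub hφ hn
  refine hφ.deriv.eventually_eq_zero_or_eventually_ne_zero.resolve_left fun h0 => ?_
  rw [analyticOrderAt_eq_top.2 h0] at h
  exact ENat.top_ne_natCast _ h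

/-- Two holomorphic functions with `dφ₂ = u dφ₁` and `du = l u dφ₁`. -/
structure Multiplier (φ₁ φ₂ u l : ℂ → ℂ) (p : ℂ) : Prop where
  an₁ : AnalyticAt ℂ φ₁ p
  an₂ : AnalyticAt ℂ φ₂ p
  an_u : AnalyticAt ℂ u p
  an_l : AnalyticAt ℂ l p
  u_ne : u p ≠ 0
  deriv_eq : ∀ᶠ z in 𝓝 p, deriv φ₂ z = u z * deriv φ₁ z
  deriv_u : ∀ᶠ z in 𝓝 p, deriv u z = l z * deriv φ₁ z * u z

lemma Multiplier.eventually {φ₁ φ₂ u l : ℂ → ℂ} {p : ℂ} (h : Multiplier φ₁ φ₂ u l p) :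
    ∀ᶠ z in 𝓝 p, Multiplier φ₁ φ₂ u l z := by
  filter_upwards [h.an₁.eventually_analyticAt, h.an₂.eventually_analyticAt,
    h.an_u.eventually_analyticAt, h.an_l.eventually_analyticAt,
    h.an_u.continuousAt.eventually_ne h.u_ne, h.deriv_eq.eventually_nhds,
    h.deriv_u.eventually_nhds] with z h1 h2 h3 h4 h5 h6 h7
  exact ⟨h1, h2, h3, h4, h5, h6, h7⟩

/-- The difference of the Schwarzian derivatives, extended across the zeros of `dφ₁`. -/
noncomputable def schwarzianDiff (φ₁ l : ℂ → ℂ) (z : ℂ) : ℂ :=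
  deriv φ₁ z * (deriv l z - deriv φ₁ z * l z ^ 2 / 2)

lemma Multiplier.analyticAt_schwarzianDiff {φ₁ φ₂ u l : ℂ → ℂ} {p : ℂ}
    (h : Multiplier φ₁ φ₂ u l p) : AnalyticAt ℂ (schwarzianDiff φ₁ l) p := by
  have h1 := h.an₁.deriv
  have h2 := h.an_l.deriv
  have h3 := h.an_l
  unfold schwarzianDiff
  fun_prop

/-- Logarithmic differentiation of φ₂' = u φ₁' gives φ₂''/φ₂' = l φ₁' + φ₁''/φ₁'. In the Schwarzian
derivative, the term l φ₁'' from the derivative cancels against the cross term of the half square.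
-/
lemma Multiplier.schwarzian_sub {φ₁ φ₂ u l : ℂ → ℂ} {p : ℂ} (h : Multiplier φ₁ φ₂ u l p)
    (h1 : deriv φ₁ p ≠ 0) : schwarzian φ₂ p - schwarzian φ₁ p = schwarzianDiff φ₁ l p := by
  have key : ∀ᶠ z in 𝓝 p, deriv (deriv φ₂) z / deriv φ₂ z =
      l z * deriv φ₁ z + deriv (deriv φ₁) z / deriv φ₁ z := by
    filter_upwards [h.deriv_eq.eventually_nhds, h.deriv_u,
      h.an₁.deriv.continuousAt.eventually_ne h1, h.an_u.continuousAt.eventually_ne h.u_ne,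
      h.an₁.eventually_analyticAt, h.an_u.eventually_analyticAt] with z e1 e2 e3 e4 e5 e6
    have : deriv (deriv φ₂) z = deriv u z * deriv φ₁ z + u z * deriv (deriv φ₁) z := by
      rw [Filter.EventuallyEq.deriv_eq e1]
      exact deriv_fun_mul e6.differentiableAt e5.deriv.differentiableAt
    rw [this, e1.self_of_nhds, e2]
    field_simp
  have hd := h.an₁.deriv
  have hdd := hd.deriv
  have hP : DifferentiableAt ℂ (fun z => deriv (deriv φ₁) z / deriv φ₁ z) p :=
    (hdd.div hd h1).differentiableAt
  have hl := h.an_l.differentiableAt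
  have e : deriv (fun z => deriv (deriv φ₂) z / deriv φ₂ z) p = deriv l p * deriv φ₁ p +
      l p * deriv (deriv φ₁) p + deriv (fun z => deriv (deriv φ₁) z / deriv φ₁ z) p := by
    rw [Filter.EventuallyEq.deriv_eq key]
    exact ((hl.hasDerivAt.mul hd.differentiableAt.hasDerivAt).add hP.hasDerivAt).deriv
  unfold schwarzian schwarzianDiff
  rw [e, key.self_of_nhds]
  field_simp
  ring

lemma order_schwarzianDiff {φ₁ l : ℂ → ℂ} {p : ℂ} {n : ℕ} (h₁ : AnalyticAt ℂ φ₁ p)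
    (hl : AnalyticAt ℂ l p)
    (hn : analyticOrderAt (fun z => φ₁ z - φ₁ p) p = ((n + 1 : ℕ) : ℕ∞)) :
    (n : ℕ∞) ≤ analyticOrderAt (schwarzianDiff φ₁ l) p := by
  have h2 := hl.deriv
  have h3 := h₁.deriv
  have : schwarzianDiff φ₁ l = deriv φ₁ * fun z => deriv l z - deriv φ₁ z * l z ^ 2 / 2 := rfl
  rw [this, analyticOrderAt_mul h3 (by fun_prop), analyticOrderAt_deriv_of_sub h₁ hn]
  exact le_self_add

/-- Two ramified coverings with the same `2(n+1)`-jet differ by a multiplier. -/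
lemma exists_multiplier {φ₁ φ₂ : ℂ → ℂ} {p : ℂ} {n : ℕ} (h₁ : AnalyticAt ℂ φ₁ p)
    (h₂ : AnalyticAt ℂ φ₂ p)
    (hn : analyticOrderAt (fun z => φ₁ z - φ₁ p) p = ((n + 1 : ℕ) : ℕ∞))
    (hj : ((2 * (n + 1) + 1 : ℕ) : ℕ∞) ≤ analyticOrderAt (φ₁ - φ₂) p) :
    ∃ u l, Multiplier φ₁ φ₂ u l p ∧ u p = 1 ∧ l p = 0 := by
  have hd := h₁.deriv
  have hdn := analyticOrderAt_deriv_of_sub h₁ hn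
  have hsub : AnalyticAt ℂ (φ₂ - φ₁) p := h₂.sub h₁
  have hzero : (φ₂ - φ₁) p = 0 := by
    apply apply_eq_zero_of_analyticOrderAt_ne_zero
    rw [← neg_sub, analyticOrderAt_neg]
    intro h0; rw [h0] at hj; simp at hj
  -- The difference has order at least 2n+3, its derivative 2n+2 = n + (n+2), and dividing by φ₁'
  -- leaves h = u - 1 of order at least n+2.
  have h1 : ((n + (n + 2) : ℕ) : ℕ∞) ≤ analyticOrderAt (deriv (φ₂ - φ₁)) p := by
    rw [analyticOrderAt_deriv_ge_iff hsub hzero, ← neg_sub, analyticOrderAt_neg]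
    refine le_trans (le_of_eq ?_) hj
    norm_cast; ring
  obtain ⟨h, hh, hho, hhe⟩ := exists_eq_mul_of_order_le hsub.deriv hd hdn h1
  have hhp : h p = 0 := by
    apply apply_eq_zero_of_analyticOrderAt_ne_zero
    intro h0; rw [h0] at hho; simp at hho
  have hu : AnalyticAt ℂ (fun z => 1 + h z) p := by fun_prop
  have hup : 1 + h p = 1 := by rw [hhp, add_zero]
  have ho : ((n + 1 : ℕ) : ℕ∞) ≤ analyticOrderAt (deriv h) p := by
    rw [analyticOrderAt_deriv_ge_iff hh hhp]
    exact_mod_cast hho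
  have hm : analyticOrderAt (deriv φ₁ * fun z => 1 + h z) p = n := by
    rw [analyticOrderAt_mul hd hu, hdn,
      (AnalyticAt.analyticOrderAt_eq_zero hu).2 (by rw [hup]; exact one_ne_zero), add_zero]
  -- Here h' has order at least n+1 and the divisor φ₁' u has order n, so one order remains and l(p)
  -- = 0.
  obtain ⟨l, hl, hlo, hle⟩ := exists_eq_mul_of_order_le hh.deriv (hd.mul hu) hm ho
  refine ⟨fun z => 1 + h z, l, ⟨h₁, h₂, hu, hl, ?_, ?_, ?_⟩, hup, ?_⟩
  · rw [hup]; exact one_ne_zero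
  · filter_upwards [hhe, h₁.eventually_analyticAt, h₂.eventually_analyticAt] with z e1 e2 e3
    rw [deriv_sub e3.differentiableAt e2.differentiableAt] at e1
    linear_combination e1
  · filter_upwards [hle] with z e1
    rw [deriv_const_add, e1]
    simp only [Pi.mul_apply]
    ring
  · apply apply_eq_zero_of_analyticOrderAt_ne_zero
    intro h0; rw [h0] at hlo; simp at hlo

/-- Uniqueness for the Riccati equation l' = φ₁' l²/2 with l(p) = 0, by counting orders: a finite
order m of l would give m - 1 ≥ 2m. So l = 0, then u = 1, and φ₁ - φ₂ is constant. -/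
lemma eventually_eq_of_schwarzianDiff_eq_zero {φ₁ φ₂ u l : ℂ → ℂ} {p : ℂ} {n : ℕ}
    (h : Multiplier φ₁ φ₂ u l p) (hu : u p = 1) (hl : l p = 0) (hv : φ₁ p = φ₂ p)
    (hn : analyticOrderAt (fun z => φ₁ z - φ₁ p) p = ((n + 1 : ℕ) : ℕ∞))
    (hz : ∀ᶠ z in 𝓝[≠] p, schwarzianDiff φ₁ l z = 0) : ∀ᶠ z in 𝓝 p, φ₁ z = φ₂ z := by
  have hd := h.an₁.deriv
  have hla := h.an_l
  have hld := hla.deriv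
  have h1 : ∀ᶠ z in 𝓝 p, deriv l z = deriv φ₁ z * l z ^ 2 / 2 := by
    refine eventually_of_punctured hld (by fun_prop) ?_
    filter_upwards [hz, eventually_deriv_ne_zero h.an₁ hn] with z e1 e2
    exact sub_eq_zero.1 ((mul_eq_zero.1 e1).resolve_left e2)
  have hl0 : ∀ᶠ z in 𝓝 p, l z = 0 := by
    rw [← analyticOrderAt_eq_top]
    by_contra hne
    have e1 := hla.analyticOrderAt_deriv_add_one
    have e2 : analyticOrderAt (deriv l) p = analyticOrderAt ((fun z => deriv φ₁ z / 2) * l ^ 2) p :=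
      analyticOrderAt_congr (h1.mono fun z hz => by
        rw [hz]; simp only [Pi.mul_apply, Pi.pow_apply]; ring)
    rw [analyticOrderAt_mul (by fun_prop) (hla.pow 2), analyticOrderAt_pow hla] at e2
    simp only [hl, sub_zero] at e1
    rw [e2] at e1
    obtain ⟨m, hm⟩ := ENat.ne_top_iff_exists.1 hne
    rw [← hm] at e1
    have e3 : (2 • (m : ℕ∞)) + 1 ≤ (m : ℕ∞) := by
      conv_rhs => rw [← e1]
      gcongr
      exact le_add_self
    rw [nsmul_eq_mul] at e3
    norm_cast at e3
    omega
  have hu1 : ∀ᶠ z in 𝓝 p, u z = 1 := by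
    rw [← hu]
    refine eventually_eq_const_of_deriv h.an_u ?_
    filter_upwards [h.deriv_u, hl0] with z e1 e2
    rw [e1, e2, zero_mul, zero_mul]
  have := eventually_eq_const_of_deriv (h.an₁.sub h.an₂) (by
    filter_upwards [h.deriv_eq, hu1, h.an₁.eventually_analyticAt,
      h.an₂.eventually_analyticAt] with z e1 e2 e3 e4
    rw [deriv_sub e3.differentiableAt e4.differentiableAt, e1, e2, one_mul, sub_self])
  filter_upwards [this] with z hz
  simp only [Pi.sub_apply, hv, sub_self] at hz
  exact sub_eq_zero.1 hz

/-- A ramified covering with prescribed `2(n+1)`-jet and prescribed Schwarzian derivative. -/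
lemma exists_prescribed_schwarzianDiff {φ₁ Q : ℂ → ℂ} {p : ℂ} {n : ℕ} (h₁ : AnalyticAt ℂ φ₁ p)
    (hQ : AnalyticAt ℂ Q p)
    (hn : analyticOrderAt (fun z => φ₁ z - φ₁ p) p = ((n + 1 : ℕ) : ℕ∞))
    (hQn : (n : ℕ∞) ≤ analyticOrderAt Q p) :
    ∃ φ₂ u l, Multiplier φ₁ φ₂ u l p ∧ (∀ᶠ z in 𝓝 p, schwarzianDiff φ₁ l z = Q z) ∧
      analyticOrderAt (fun z => φ₂ z - φ₂ p) p = ((n + 1 : ℕ) : ℕ∞) ∧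
      ((2 * (n + 1) + 1 : ℕ) : ℕ∞) ≤ analyticOrderAt (φ₁ - φ₂) p := by
  have hd := h₁.deriv
  have hdn := analyticOrderAt_deriv_of_sub h₁ hn
  obtain ⟨r, hr, -, hrQ⟩ := exists_eq_mul_of_order_le (k := 0) hQ hd hdn hQn
  -- Linearisation of l' - φ₁' l²/2 = r, where r = Q/φ₁': set l = -2γ/v and u = v⁻², so that u'/u =
  -- -2v'/v = l φ₁'.
  obtain ⟨v, γ, hv, hγ, hvp, hγp, hsys⟩ :=
    exists_linear_system hd (B := fun z => -(r z) / 2) (by fun_prop)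
  have hvne : v p ≠ 0 := by rw [hvp]; exact one_ne_zero
  have hua : AnalyticAt ℂ (fun z => (v z ^ 2)⁻¹) p := (hv.pow 2).inv (pow_ne_zero 2 hvne)
  have hla : AnalyticAt ℂ (fun z => -2 * γ z / v z) p :=
    (analyticAt_const.mul hγ).div hv hvne
  have hwa : AnalyticAt ℂ (fun z => (v z ^ 2)⁻¹ * deriv φ₁ z) p := hua.mul hd
  obtain ⟨ρ, hρ, hball⟩ := Metric.eventually_nhds_iff_ball.1 hwa.eventually_analyticAt
  obtain ⟨F, hFp, hF⟩ := exists_primitive_ball p ρ _ fun z hz =>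
    (hball z hz).differentiableAt.differentiableWithinAt
  have hFa : AnalyticAt ℂ F p := by
    refine DifferentiableOn.analyticAt (s := Metric.ball p ρ) (fun z hz =>
      (hF z hz).differentiableAt.differentiableWithinAt) (Metric.ball_mem_nhds p hρ)
  have hFd : ∀ᶠ z in 𝓝 p, deriv F z = (v z ^ 2)⁻¹ * deriv φ₁ z :=
    (Metric.eventually_nhds_iff_ball.2 ⟨ρ, hρ, fun z hz => hF z hz⟩).mono fun z hz => hz.deriv
  have hφd : ∀ z, deriv (fun w => φ₁ p + F w) z = deriv F z := fun z => by rw [deriv_const_add]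
  have hvne' := hv.continuousAt.eventually_ne hvne
  have hvd : ∀ᶠ z in 𝓝 p, deriv (fun z => v z - 1) z = deriv φ₁ z * γ z := by
    filter_upwards [hsys] with z e
    rw [deriv_sub_const, e.1.deriv]
  have hφ₂ : AnalyticAt ℂ (fun w => φ₁ p + F w) p := by fun_prop
  have hγo : (1 : ℕ∞) ≤ analyticOrderAt γ p :=
    Order.one_le_iff_ne_zero.2 (hγ.analyticOrderAt_ne_zero.2 hγp)
  have hv1 : AnalyticAt ℂ (fun z => v z - 1) p := by fun_prop
  -- Since γ(p) = 0, the derivative φ₁' γ of v has order at least n+1. This is what keeps the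
  -- 2(n+1)-jet unchanged.
  have hv1o : ((n + 2 : ℕ) : ℕ∞) ≤ analyticOrderAt (fun z => v z - 1) p := by
    have := analyticOrderAt_deriv_ge_iff (n := n + 1) hv1 (by simp [hvp])
    rw [show ((n + 2 : ℕ) : ℕ∞) = ((n + 1 : ℕ) : ℕ∞) + 1 by norm_cast, ← this,
      analyticOrderAt_congr hvd]
    show _ ≤ analyticOrderAt (deriv φ₁ * γ) p
    rw [analyticOrderAt_mul hd hγ, hdn, Nat.cast_add, Nat.cast_one]
    gcongr
  have hsub : AnalyticAt ℂ (φ₁ - fun w => φ₁ p + F w) p := h₁.sub hφ₂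
  refine ⟨fun w => φ₁ p + F w, fun z => (v z ^ 2)⁻¹, fun z => -2 * γ z / v z,
    ⟨h₁, hφ₂, hua, hla, inv_ne_zero (pow_ne_zero 2 hvne), ?_, ?_⟩, ?_, ?_, ?_⟩
  · filter_upwards [hFd] with z e
    rw [hφd, e]
  · filter_upwards [hsys, hvne'] with z e1 e2
    have := ((e1.1.pow 2).inv (pow_ne_zero 2 e2)).deriv
    simp only [Pi.pow_apply] at this
    refine this.trans ?_
    simp only [Nat.cast_ofNat, Nat.add_one_sub_one, pow_one]
    field_simp
  · filter_upwards [hsys, hvne', hrQ] with z e1 e2 e3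
    have := ((e1.2.const_mul (-2)).div e1.1 e2).deriv
    unfold schwarzianDiff
    rw [show deriv (fun z => -2 * γ z / v z) z = _ from this, e3]
    field_simp
    ring
  · rw [← hφ₂.analyticOrderAt_deriv_add_one, Nat.cast_add, Nat.cast_one]
    congr 1
    rw [show deriv (fun w => φ₁ p + F w) = deriv F from funext hφd, analyticOrderAt_congr hFd]
    show analyticOrderAt ((fun z => (v z ^ 2)⁻¹) * deriv φ₁) p = n
    rw [analyticOrderAt_mul hua hd, hdn, hua.analyticOrderAt_eq_zero.2
      (inv_ne_zero (pow_ne_zero 2 hvne)), zero_add]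
  · have := analyticOrderAt_deriv_ge_iff (n := n + (n + 2)) hsub (by simp [hFp])
    rw [show ((2 * (n + 1) + 1 : ℕ) : ℕ∞) = ((n + (n + 2) : ℕ) : ℕ∞) + 1 by norm_cast; ring, ← this]
    -- From φ₁' - φ₂' = φ₁' (v - 1)(v + 1)/v² the order is at least n + (n+2); integration adds one.
    have e : ∀ᶠ z in 𝓝 p, deriv (φ₁ - fun w => φ₁ p + F w) z =
        (deriv φ₁ * ((fun z => v z - 1) * fun z => (v z + 1) * (v z ^ 2)⁻¹)) z := by
      filter_upwards [hFd, hvne', h₁.eventually_analyticAt, hφ₂.eventually_analyticAt]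
        with z e1 e2 e3 e4
      rw [deriv_sub e3.differentiableAt e4.differentiableAt, hφd, e1]
      simp only [Pi.mul_apply]
      field_simp
      ring
    have hg : AnalyticAt ℂ (fun z => (v z + 1) * (v z ^ 2)⁻¹) p := by fun_prop
    rw [analyticOrderAt_congr e, analyticOrderAt_mul hd (hv1.mul hg), hdn,
      analyticOrderAt_mul hv1 hg, Nat.cast_add]
    gcongr
    exact hv1o.trans le_self_add

/-- Postcomposition with a Möbius map has multiplier u = (ad - bc)/(cφ + d)² and l = -2c/(cφ + d),
which solves the Riccati equation with right-hand side zero. -/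
lemma schwarzian_moebius {φ ψ : ℂ → ℂ} {p a b c d : ℂ} (hφ : AnalyticAt ℂ φ p)
    (hdet : a * d - b * c ≠ 0) (hne : c * φ p + d ≠ 0) (h1 : deriv φ p ≠ 0)
    (h : ∀ᶠ z in 𝓝 p, ψ z = (a * φ z + b) / (c * φ z + d)) : schwarzian ψ p = schwarzian φ p := by
  have hda : AnalyticAt ℂ (fun z => c * φ z + d) p := by fun_prop
  have hχ : AnalyticAt ℂ (fun z => (a * φ z + b) / (c * φ z + d)) p :=
    AnalyticAt.div (by fun_prop) hda hne
  have ev := hda.continuousAt.eventually_ne hne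
  have hψ : AnalyticAt ℂ ψ p := hχ.congr (h.mono fun _ hz => hz.symm)
  have hM : Multiplier φ ψ (fun z => (a * d - b * c) / (c * φ z + d) ^ 2)
      (fun z => -2 * c / (c * φ z + d)) p := by
    refine ⟨hφ, hψ, analyticAt_const.div (hda.pow 2) (pow_ne_zero 2 hne),
      analyticAt_const.div hda hne, div_ne_zero hdet (pow_ne_zero 2 hne), ?_, ?_⟩
    · filter_upwards [h.eventually_nhds, ev, hφ.eventually_analyticAt] with z e1 e2 e3
      have e3 := e3.differentiableAt.hasDerivAt
      rw [Filter.EventuallyEq.deriv_eq e1]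
      refine ((((e3.const_mul a).add_const b).div ((e3.const_mul c).add_const d) e2).deriv).trans ?_
      field_simp
      ring
    · filter_upwards [ev, hφ.eventually_analyticAt] with z e2 e3
      have e3 := e3.differentiableAt.hasDerivAt
      refine ((hasDerivAt_const z (a * d - b * c)).div (((e3.const_mul c).add_const d).pow 2)
        (pow_ne_zero 2 e2)).deriv.trans ?_
      simp only [Pi.pow_apply, Nat.cast_ofNat]
      field_simp
      ring
  rw [← sub_eq_zero, hM.schwarzian_sub h1]
  have hd : deriv (fun z => -2 * c / (c * φ z + d)) p =
      2 * c ^ 2 * deriv φ p / (c * φ p + d) ^ 2 := by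
    have e3 := hφ.differentiableAt.hasDerivAt
    refine ((hasDerivAt_const p (-2 * c)).div ((e3.const_mul c).add_const d) hne).deriv.trans ?_
    field_simp
    ring
  unfold schwarzianDiff
  rw [hd]
  field_simp
  ring

/-- The inhomogeneous term depends on σ alone, so it cancels in differences, which therefore
transform as quadratic differentials. -/
lemma schwarzian_comp {φ σ : ℂ → ℂ} {p : ℂ} (hσ : AnalyticAt ℂ σ p) (hφ : AnalyticAt ℂ φ (σ p))
    (h1 : deriv σ p ≠ 0) (h2 : deriv φ (σ p) ≠ 0) :
    schwarzian (φ ∘ σ) p = deriv σ p ^ 2 * schwarzian φ (σ p) + schwarzian σ p := by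
  have hd : ∀ᶠ z in 𝓝 p, deriv (φ ∘ σ) z = deriv φ (σ z) * deriv σ z := by
    filter_upwards [hσ.continuousAt.eventually hφ.eventually_analyticAt,
      hσ.eventually_analyticAt] with z e1 e2
    exact deriv_comp z e1.differentiableAt e2.differentiableAt
  have hne : ∀ᶠ z in 𝓝 p, deriv φ (σ z) ≠ 0 :=
    hσ.continuousAt.eventually (hφ.deriv.continuousAt.eventually_ne h2)
  have key : ∀ᶠ z in 𝓝 p, deriv (deriv (φ ∘ σ)) z / deriv (φ ∘ σ) z =
      deriv (deriv φ) (σ z) / deriv φ (σ z) * deriv σ z + deriv (deriv σ) z / deriv σ z := by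
    filter_upwards [hd.eventually_nhds, hσ.continuousAt.eventually hφ.eventually_analyticAt,
      hσ.eventually_analyticAt, hne, hσ.deriv.continuousAt.eventually_ne h1] with z e1 e2 e3 e4 e5
    rw [e1.self_of_nhds, Filter.EventuallyEq.deriv_eq e1]
    have := ((e2.deriv.differentiableAt.hasDerivAt.comp z e3.differentiableAt.hasDerivAt).mul
      e3.deriv.differentiableAt.hasDerivAt).deriv
    rw [show deriv (fun x => deriv φ (σ x) * deriv σ x) z = _ from this]
    simp only [Function.comp_apply]
    field_simp
  have hP : DifferentiableAt ℂ (fun w => deriv (deriv φ) w / deriv φ w) (σ p) :=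
    (hφ.deriv.deriv.div hφ.deriv h2).differentiableAt
  have hR : DifferentiableAt ℂ (fun w => deriv (deriv σ) w / deriv σ w) p :=
    (hσ.deriv.deriv.div hσ.deriv h1).differentiableAt
  have e : deriv (fun w => deriv (deriv (φ ∘ σ)) w / deriv (φ ∘ σ) w) p =
      deriv (fun w => deriv (deriv φ) w / deriv φ w) (σ p) * deriv σ p * deriv σ p +
        deriv (deriv φ) (σ p) / deriv φ (σ p) * deriv (deriv σ) p +
        deriv (fun w => deriv (deriv σ) w / deriv σ w) p := by
    rw [Filter.EventuallyEq.deriv_eq key]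
    exact (((hP.hasDerivAt.comp p hσ.differentiableAt.hasDerivAt).mul
      hσ.deriv.differentiableAt.hasDerivAt).add hR.hasDerivAt).deriv
  unfold schwarzian
  rw [e, key.self_of_nhds]
  field_simp
  ring

end NormalForms

/-! ### Coordinate changes, affine representations and jet orbits on the surface. -/

section GermLemmas

universe u

variable {X : Type u} [TopologicalSpace X] [ChartedSpace ℂ X]

/-- The change of coordinates from the preferred chart at `y` to the preferred chart at `x`. -/
noncomputable def coordChange (x y : X) : ℂ → ℂ := chartAt ℂ x ∘ (chartAt ℂ y).symm

lemma coordChange_apply (x y : X) : coordChange x y (chartAt ℂ y y) = chartAt ℂ x y := by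
  simp [coordChange]

lemma analyticAt_coordChange [IsManifold 𝓘(ℂ, ℂ) ω X] (x y : X) {w : X}
    (hy : w ∈ (chartAt ℂ y).source) (hx : w ∈ (chartAt ℂ x).source) :
    AnalyticAt ℂ (coordChange x y) (chartAt ℂ y w) := by
  have h := contDiffWithinAt_ext_coord_change (I := 𝓘(ℂ, ℂ)) (n := ω) x y
    (y := chartAt ℂ y w) (by simp [hy, hx])
  simp only [mfld_simps, contDiffWithinAt_univ] at h
  exact h.analyticAt

lemma coordChange_comp_eventuallyEq (x y : X) {w : X}
    (hy : w ∈ (chartAt ℂ y).source) (hx : w ∈ (chartAt ℂ x).source) :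
    coordChange y x ∘ coordChange x y =ᶠ[𝓝 (chartAt ℂ y w)] id := by
  have hc := (chartAt ℂ y).symm.continuousAt ((chartAt ℂ y).map_source hy)
  rw [ContinuousAt, (chartAt ℂ y).left_inv hy] at hc
  filter_upwards [hc.eventually ((chartAt ℂ x).open_source.mem_nhds hx),
    (chartAt ℂ y).open_target.mem_nhds ((chartAt ℂ y).map_source hy)] with z h1 h2
  simp only [coordChange, Function.comp_apply, id]
  rw [(chartAt ℂ x).left_inv h1, (chartAt ℂ y).right_inv h2]

lemma deriv_coordChange_mul [IsManifold 𝓘(ℂ, ℂ) ω X] (x y : X) {w : X}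
    (hy : w ∈ (chartAt ℂ y).source) (hx : w ∈ (chartAt ℂ x).source) :
    deriv (coordChange y x) (chartAt ℂ x w) * deriv (coordChange x y) (chartAt ℂ y w) = 1 := by
  have h1 := (analyticAt_coordChange x y hy hx).differentiableAt
  have h2 := (analyticAt_coordChange y x hx hy).differentiableAt
  have e : coordChange x y (chartAt ℂ y w) = chartAt ℂ x w := by
    simp [coordChange, (chartAt ℂ y).left_inv hy]
  have := (coordChange_comp_eventuallyEq x y hy hx).deriv_eq
  rw [deriv_comp _ (by rwa [e]) h1, e, deriv_id] at this
  exact this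

lemma bilin_smul_one (d : ℂ) (B : ℂ →ₗ[ℂ] ℂ →ₗ[ℂ] ℂ) :
    B (d • (1 : ℂ)) (d • (1 : ℂ)) = d ^ 2 * B 1 1 := by
  rw [B.map_smul, LinearMap.smul_apply, (B 1).map_smul, smul_eq_mul, smul_eq_mul]
  ring

/-- The tangent space at y is ℂ through the preferred chart at y. The coordinate vector field of the
chart at x therefore reads there as the derivative of the coordinate change, which enters squared.
-/
lemma coeff_apply [IsManifold 𝓘(ℂ, ℂ) ω X] {U : Opens X} (q : RoughQuadDiff U) (x y : X) {z : ℂ}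
    (hz : z ∈ (chartAt ℂ x).target) (hzy : (chartAt ℂ x).symm z = y) (hy : y ∈ U) :
    coeff q (chartAt ℂ x) z = deriv (coordChange y x) z ^ 2 *
      q ⟨y, hy⟩ (1 : ℂ) (1 : ℂ) := by
  subst hzy
  have hm : MDifferentiableAt 𝓘(ℂ, ℂ) 𝓘(ℂ, ℂ) (chartAt ℂ x).symm z :=
    mdifferentiableAt_atlas_symm (chart_mem_atlas ℂ x) hz
  have hd : mfderiv 𝓘(ℂ, ℂ) 𝓘(ℂ, ℂ) (chartAt ℂ x).symm z (1 : ℂ) =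
      (deriv (coordChange ((chartAt ℂ x).symm z) x) z • (1 : ℂ) : ℂ) := by
    rw [hm.mfderiv]
    simp only [mfld_simps, fderivWithin_univ, smul_eq_mul, mul_one]
    rfl
  rw [coeff, dif_pos hy, hd]
  exact bilin_smul_one _ (q ⟨(chartAt ℂ x).symm z, hy⟩)

lemma coeff_self [IsManifold 𝓘(ℂ, ℂ) ω X] {U : Opens X} (q : RoughQuadDiff U) {x : X}
    (hx : x ∈ U) : coeff q (chartAt ℂ x) (chartAt ℂ x x) = q ⟨x, hx⟩ (1 : ℂ) (1 : ℂ) := by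
  have hs := mem_chart_source ℂ x
  rw [coeff_apply q x x ((chartAt ℂ x).map_source hs) ((chartAt ℂ x).left_inv hs) hx, sq,
    deriv_coordChange_mul x x hs hs, one_mul]

lemma coeff_self_eq [IsManifold 𝓘(ℂ, ℂ) ω X] {U : Opens X} (q : RoughQuadDiff U) {x y : X}
    (hy : y ∈ U) (hx : y ∈ (chartAt ℂ x).source) :
    coeff q (chartAt ℂ y) (chartAt ℂ y y) =
      deriv (coordChange x y) (chartAt ℂ y y) ^ 2 * coeff q (chartAt ℂ x) (chartAt ℂ x y) := by
  rw [coeff_self q hy, coeff_apply q x y ((chartAt ℂ x).map_source hx)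
    ((chartAt ℂ x).left_inv hx) hy, ← mul_assoc, ← mul_pow, mul_comm (deriv _ _),
    deriv_coordChange_mul x y (mem_chart_source ℂ y) hx, one_pow, one_mul]

lemma tendsto_chart_punctured (x : X) :
    Filter.Tendsto (chartAt ℂ x) (𝓝[≠] x) (𝓝[≠] (chartAt ℂ x x)) := by
  have hs := mem_chart_source ℂ x
  refine tendsto_nhdsWithin_iff.2
    ⟨((chartAt ℂ x).continuousAt hs).tendsto.mono_left nhdsWithin_le_nhds, ?_⟩
  filter_upwards [self_mem_nhdsWithin,
    nhdsWithin_le_nhds ((chartAt ℂ x).open_source.mem_nhds hs)] with y h1 h2 h3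
  exact h1 ((chartAt ℂ x).injOn h2 hs h3)

lemma tendsto_chart_symm (x : X) :
    Filter.Tendsto (chartAt ℂ x).symm (𝓝 (chartAt ℂ x x)) (𝓝 x) := by
  have hs := mem_chart_source ℂ x
  have := (chartAt ℂ x).symm.continuousAt ((chartAt ℂ x).map_source hs)
  rwa [ContinuousAt, (chartAt ℂ x).left_inv hs] at this

lemma tendsto_chart_symm_punctured (x : X) :
    Filter.Tendsto (chartAt ℂ x).symm (𝓝[≠] (chartAt ℂ x x)) (𝓝[≠] x) := by
  have hs := mem_chart_source ℂ x
  refine tendsto_nhdsWithin_iff.2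
    ⟨(tendsto_chart_symm x).mono_left nhdsWithin_le_nhds, ?_⟩
  filter_upwards [self_mem_nhdsWithin, nhdsWithin_le_nhds
    ((chartAt ℂ x).open_target.mem_nhds ((chartAt ℂ x).map_source hs))] with z h1 h2 h3
  exact h1 (by rw [← (chartAt ℂ x).right_inv h2, show (chartAt ℂ x).symm z = x from h3]; rfl)

lemma chart_right_inv_eventually (x : X) :
    ∀ᶠ z in 𝓝 (chartAt ℂ x x), chartAt ℂ x ((chartAt ℂ x).symm z) = z := by
  filter_upwards [(chartAt ℂ x).open_target.mem_nhds
    ((chartAt ℂ x).map_source (mem_chart_source ℂ x))] with z hz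
  exact (chartAt ℂ x).right_inv hz

/-! ### Affine representations -/

lemma AffineRep.congr {f f' : X → OnePoint ℂ} {x : X} {g : GL (Fin 2) ℂ} {φ : ℂ → ℂ}
    (h : AffineRep f x g φ) (hf : ∀ᶠ y in 𝓝 x, f' y = f y) : AffineRep f' x g φ :=
  ⟨h.1, by filter_upwards [h.2, hf] with y h1 h2; rw [h2, h1]⟩

lemma AffineRep.of_smul {f f' : X → OnePoint ℂ} {x : X} {g m : GL (Fin 2) ℂ} {φ : ℂ → ℂ}
    (h : AffineRep f' x g φ) (hf : ∀ᶠ y in 𝓝 x, f' y = m • f y) : AffineRep f x (m⁻¹ * g) φ :=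
  (h.smul m⁻¹).congr (hf.mono fun y hy => by rw [Pi.smul_apply, hy, inv_smul_smul])

lemma AffineRep.moebius {f : X → OnePoint ℂ} {x : X} {g g' : GL (Fin 2) ℂ} {φ φ' : ℂ → ℂ}
    (h : AffineRep f x g φ) (h' : AffineRep f x g' φ') :
    ∃ a b c d : ℂ, a * d - b * c ≠ 0 ∧ c * φ (chartAt ℂ x x) + d ≠ 0 ∧
      ∀ᶠ z in 𝓝 (chartAt ℂ x x), φ' z = (a * φ z + b) / (c * φ z + d) := by
  have hm := h.eventually_smul h'
  set m := g'⁻¹ * g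
  -- A zero denominator would make the image ∞, whereas φ' takes finite values.
  have hne : ∀ z, m • (φ z : OnePoint ℂ) = (φ' z : OnePoint ℂ) → m 1 0 * φ z + m 1 1 ≠ 0 := by
    intro z hz h0
    rw [OnePoint.smul_some_eq_ite, if_pos h0] at hz
    exact OnePoint.infty_ne_coe _ hz
  refine ⟨m 0 0, m 0 1, m 1 0, m 1 1, ?_, hne _ hm.self_of_nhds, ?_⟩
  · have := m.det_ne_zero
    rwa [Matrix.det_fin_two] at this
  · filter_upwards [hm] with z hz
    have h1 := hz
    rw [smul_coe_of_ne (hne z hz), OnePoint.coe_eq_coe] at h1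
    exact h1.symm

lemma order_moebius {φ φ' : ℂ → ℂ} {p a b c d : ℂ} (hφ : AnalyticAt ℂ φ p)
    (hdet : a * d - b * c ≠ 0) (hne : c * φ p + d ≠ 0)
    (h : ∀ᶠ z in 𝓝 p, φ' z = (a * φ z + b) / (c * φ z + d)) :
    analyticOrderAt (fun z => φ' z - φ' p) p = analyticOrderAt (fun z => φ z - φ p) p := by
  have hda : AnalyticAt ℂ (fun z => c * φ z + d) p := by fun_prop
  have hA : AnalyticAt ℂ (fun z => (a * d - b * c) / ((c * φ z + d) * (c * φ p + d))) p :=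
    analyticAt_const.div (hda.mul analyticAt_const) (mul_ne_zero hne hne)
  have e : ∀ᶠ z in 𝓝 p, φ' z - φ' p =
      ((fun z => (a * d - b * c) / ((c * φ z + d) * (c * φ p + d))) * fun z => φ z - φ p) z := by
    filter_upwards [h, hda.continuousAt.eventually_ne hne] with z h1 h2
    rw [h1, h.self_of_nhds]
    simp only [Pi.mul_apply]
    rw [div_sub_div _ _ h2 hne, div_mul_eq_mul_div]
    congr 1
    ring
  rw [analyticOrderAt_congr e, analyticOrderAt_mul hA (by fun_prop),
    hA.analyticOrderAt_eq_zero.2 (div_ne_zero hdet (mul_ne_zero hne hne)), zero_add]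

lemma AffineRep.order_eq {f : X → OnePoint ℂ} {x : X} {g : GL (Fin 2) ℂ} {φ : ℂ → ℂ} {n : ℕ}
    (h : AffineRep f x g φ) (hf : RamifiedAt f x n) :
    analyticOrderAt (fun z => φ z - φ (chartAt ℂ x x)) (chartAt ℂ x x) = ((n + 1 : ℕ) : ℕ∞) := by
  obtain ⟨g', φ', h', ho⟩ := hf
  obtain ⟨a, b, c, d, h1, h2, h3⟩ := h'.moebius h
  rw [order_moebius h'.1 h1 h2 h3, ho]

lemma AffineRep.schwarzian_eq {f : X → OnePoint ℂ} {x : X} {g g' : GL (Fin 2) ℂ} {φ φ' : ℂ → ℂ}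
    (h : AffineRep f x g φ) (h' : AffineRep f x g' φ') (hd : deriv φ (chartAt ℂ x x) ≠ 0) :
    schwarzian φ' (chartAt ℂ x x) = schwarzian φ (chartAt ℂ x x) := by
  obtain ⟨a, b, c, d, h1, h2, h3⟩ := h.moebius h'
  exact schwarzian_moebius h.1 h1 h2 hd h3

lemma AffineRep.deriv_ne_zero {f : X → OnePoint ℂ} {x : X} {g : GL (Fin 2) ℂ} {φ : ℂ → ℂ}
    (h : AffineRep f x g φ) (hf : RamifiedAt f x 0) : deriv φ (chartAt ℂ x x) ≠ 0 := by
  have h1 := analyticOrderAt_deriv_of_sub h.1 (h.order_eq hf)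
  exact (h.1.deriv.analyticOrderAt_eq_zero).1 (by simpa using h1)

lemma AffineRep.ramifiedAt_zero {f : X → OnePoint ℂ} {x : X} {g : GL (Fin 2) ℂ} {φ : ℂ → ℂ}
    (h : AffineRep f x g φ) (hd : deriv φ (chartAt ℂ x x) ≠ 0) : RamifiedAt f x 0 :=
  ⟨g, φ, h, by simpa using h.1.analyticOrderAt_sub_eq_one_of_deriv_ne_zero hd⟩

lemma RamifiedAt.not_eventually_const {f : X → OnePoint ℂ} {x : X} {n : ℕ}
    (h : RamifiedAt f x n) : ¬ ∀ᶠ y in 𝓝 x, f y = f x := by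
  intro hc
  obtain ⟨g, φ, h, ho⟩ := h
  have e : ∀ᶠ z in 𝓝 (chartAt ℂ x x), φ z - φ (chartAt ℂ x x) = 0 := by
    filter_upwards [(tendsto_chart_symm x).eventually hc, (tendsto_chart_symm x).eventually h.2,
      chart_right_inv_eventually x] with z h1 h2 h3
    rw [h1, h3, h.2.self_of_nhds, smul_left_cancel_iff, OnePoint.coe_eq_coe] at h2
    rw [h2, sub_self]
  rw [analyticOrderAt_eq_top.2 e] at ho
  exact ENat.top_ne_natCast _ ho

lemma AffineRep.eventually_at [IsManifold 𝓘(ℂ, ℂ) ω X] {f : X → OnePoint ℂ} {x : X}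
    {g : GL (Fin 2) ℂ} {φ : ℂ → ℂ} (h : AffineRep f x g φ) :
    ∀ᶠ y in 𝓝 x, y ∈ (chartAt ℂ x).source ∧ AnalyticAt ℂ φ (chartAt ℂ x y) ∧
      AffineRep f y g (φ ∘ coordChange x y) := by
  have hs := mem_chart_source ℂ x
  filter_upwards [((chartAt ℂ x).continuousAt hs).eventually h.1.eventually_analyticAt,
    h.2.eventually_nhds, (chartAt ℂ x).open_source.mem_nhds hs] with y h1 h2 h3
  refine ⟨h3, h1, ?_, ?_⟩
  · refine AnalyticAt.comp ?_ (analyticAt_coordChange x y (mem_chart_source ℂ y) h3)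
    rwa [coordChange_apply]
  · filter_upwards [h2, (chartAt ℂ y).open_source.mem_nhds (mem_chart_source ℂ y)] with w e1 e2
    rw [e1, Function.comp_apply, coordChange, Function.comp_apply, (chartAt ℂ y).left_inv e2]

lemma deriv_coordChange_ne_zero [IsManifold 𝓘(ℂ, ℂ) ω X] {x y : X}
    (h : y ∈ (chartAt ℂ x).source) : deriv (coordChange x y) (chartAt ℂ y y) ≠ 0 :=
  right_ne_zero_of_mul_eq_one (deriv_coordChange_mul x y (mem_chart_source ℂ y) h)

lemma deriv_comp_coordChange [IsManifold 𝓘(ℂ, ℂ) ω X] {x y : X} {φ : ℂ → ℂ}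
    (h : y ∈ (chartAt ℂ x).source) (hφ : AnalyticAt ℂ φ (chartAt ℂ x y)) :
    deriv (φ ∘ coordChange x y) (chartAt ℂ y y) =
      deriv φ (chartAt ℂ x y) * deriv (coordChange x y) (chartAt ℂ y y) := by
  rw [deriv_comp _ (by rw [coordChange_apply]; exact hφ.differentiableAt)
    (analyticAt_coordChange x y (mem_chart_source ℂ y) h).differentiableAt, coordChange_apply]

lemma RamifiedAt.holomorphicNear {f : X → OnePoint ℂ} {x : X} {n : ℕ} (h : RamifiedAt f x n) :
    HolomorphicNear f x := by
  obtain ⟨g, φ, h, -⟩ := h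
  exact ⟨g, φ, h⟩

lemma RamifiedAt.eventually_unramified [IsManifold 𝓘(ℂ, ℂ) ω X] {f : X → OnePoint ℂ} {x : X}
    {n : ℕ} (h : RamifiedAt f x n) : ∀ᶠ y in 𝓝[≠] x, RamifiedAt f y 0 := by
  obtain ⟨g, φ, h, ho⟩ := h
  filter_upwards [nhdsWithin_le_nhds h.eventually_at,
    (tendsto_chart_punctured x).eventually (eventually_deriv_ne_zero h.1 ho)] with y h1 h2
  refine h1.2.2.ramifiedAt_zero ?_
  rw [deriv_comp_coordChange h1.1 h1.2.1]
  exact mul_ne_zero h2 (deriv_coordChange_ne_zero h1.1)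

/-! ### Orbits of jets -/

lemma RamifiedAt.of_eventually_smul {f f' : X → OnePoint ℂ} {x : X} {n : ℕ} {m : GL (Fin 2) ℂ}
    (h : RamifiedAt f x n) (hf : ∀ᶠ y in 𝓝 x, f' y = m • f y) : RamifiedAt f' x n := by
  obtain ⟨g, φ, h, ho⟩ := h
  exact ⟨m * g, φ, (h.smul m).congr hf, ho⟩

lemma jetOrbit_eq_iff {f f' : X → OnePoint ℂ} {x : X} {n : ℕ} (h : RamifiedAt f x n)
    (h' : RamifiedAt f' x n) :
    jetOrbit h = jetOrbit h' ↔ ∃ m : GL (Fin 2) ℂ, SameJet (2 * (n + 1)) x (m • f') f := by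
  constructor
  · intro e
    obtain ⟨m, hm⟩ : ∃ m : GL (Fin 2) ℂ, 
        m • (show RamJet x n from Quotient.mk (jetSetoid x n) ⟨f', h'⟩) =
          Quotient.mk (jetSetoid x n) ⟨f, h⟩ := Quotient.exact e
    exact ⟨m, Quotient.exact hm⟩
  · rintro ⟨m, hm⟩
    apply Quotient.sound
    exact ⟨m, Quotient.sound hm⟩

lemma jetOrbit_eq_of_smul {f f' : X → OnePoint ℂ} {x : X} {n : ℕ} {m : GL (Fin 2) ℂ}
    (h : RamifiedAt f x n) (h' : RamifiedAt f' x n) (hf : ∀ᶠ y in 𝓝 x, f' y = m • f y) :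
    jetOrbit h' = jetOrbit h := by
  rw [jetOrbit_eq_iff]
  obtain ⟨g, φ, h1, -⟩ := h
  refine ⟨m, m * g, φ, φ, h1.smul m, (h1.smul m).congr hf, ?_⟩
  rw [sub_self, analyticOrderAt_eq_top.2 (by simp)]
  exact le_top

lemma exists_affineReps_of_jetOrbit_eq {f f' : X → OnePoint ℂ} {x : X} {n : ℕ}
    {h : RamifiedAt f x n} {h' : RamifiedAt f' x n} (e : jetOrbit h = jetOrbit h') :
    ∃ g φ g' φ', AffineRep f x g φ ∧ AffineRep f' x g' φ' ∧
      ((2 * (n + 1) + 1 : ℕ) : ℕ∞) ≤ analyticOrderAt (φ - φ') (chartAt ℂ x x) := by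
  obtain ⟨m, g, φ', φ, h1, h2, h3⟩ := (jetOrbit_eq_iff h h').1 e
  refine ⟨g, φ, m⁻¹ * g, φ', h2, h1.of_smul (.of_forall fun _ => rfl), ?_⟩
  rwa [← neg_sub, analyticOrderAt_neg]

/-- Möbius transformations act transitively on `2`-jets of unramified germs. -/
lemma jetOrbit_zero_eq {f f' : X → OnePoint ℂ} {x : X} (h : RamifiedAt f x 0)
    (h' : RamifiedAt f' x 0) : jetOrbit h = jetOrbit h' := by
  rw [jetOrbit_eq_iff]
  obtain ⟨g, φ, h1, -⟩ := id h
  obtain ⟨g', φ', h1', -⟩ := id h'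
  have hd := h1.deriv_ne_zero h
  have hd' := h1'.deriv_ne_zero h'
  set p := chartAt ℂ x x with hp
  obtain ⟨hφ, hf⟩ := h1
  obtain ⟨hφ', hf'⟩ := id h1'
  -- The Möbius map sought is w ↦ c + A(w - b)/(1 + C(w - b)). It sends b to c, and A and C are
  -- determined by matching the first and second derivatives at p.
  set A := deriv φ p / deriv φ' p with hA
  set C := (deriv (deriv φ') p * A - deriv (deriv φ) p) / (2 * A * deriv φ' p ^ 2) with hC
  set b := φ' p with hb
  set c := φ p with hc
  have hA0 : A ≠ 0 := div_ne_zero hd hd'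
  -- The same map over a common denominator; its determinant is A.
  let M : Matrix (Fin 2) (Fin 2) ℂ := !![A + c * C, -A * b + c - c * C * b; C, 1 - C * b]
  have hM : M.det ≠ 0 := by
    rw [Matrix.det_fin_two_of]
    convert hA0 using 1
    ring
  let m : GL (Fin 2) ℂ := Matrix.GeneralLinearGroup.mkOfDetNeZero M hM
  have m00 : m 0 0 = A + c * C := rfl
  have m01 : m 0 1 = -A * b + c - c * C * b := rfl
  have m10 : m 1 0 = C := rfl
  have m11 : m 1 1 = 1 - C * b := rfl
  have hden : AnalyticAt ℂ (fun z => 1 + C * (φ' z - b)) p := by fun_prop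
  have hden0 : 1 + C * (φ' p - b) ≠ 0 := by rw [hb, sub_self, mul_zero, add_zero]; exact one_ne_zero
  let χ : ℂ → ℂ := fun z => c + A * (φ' z - b) / (1 + C * (φ' z - b))
  have hχ : AnalyticAt ℂ χ p := by
    have : AnalyticAt ℂ (fun z => A * (φ' z - b) / (1 + C * (φ' z - b))) p :=
      AnalyticAt.div (by fun_prop) hden hden0
    fun_prop
  have hev := hden.continuousAt.eventually_ne hden0
  have hcont : ContinuousAt (chartAt ℂ x) x := (chartAt ℂ x).continuousAt (mem_chart_source ℂ x)
  refine ⟨g * m * g'⁻¹, g, χ, φ, ⟨hχ, ?_⟩, ⟨hφ, hf⟩, ?_⟩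
  · filter_upwards [hf', hcont.eventually hev] with y hy hy'
    have hne : m 1 0 * φ' (chartAt ℂ x y) + m 1 1 ≠ 0 := by
      rw [m10, m11]; convert hy' using 1; ring
    have hne' : C * φ' (chartAt ℂ x y) + (1 - C * b) ≠ 0 := hne
    rw [Pi.smul_apply, hy, mul_smul, inv_smul_smul, mul_smul, smul_coe_of_ne hne, m00, m01, m10,
      m11]
    congr 2
    simp only [χ]
    rw [show 1 + C * (φ' (chartAt ℂ x y) - b) = C * φ' (chartAt ℂ x y) + (1 - C * b) by ring]
    field_simp
    ring
  · have hdχ : ∀ᶠ z in 𝓝 p, deriv χ z = A * deriv φ' z / (1 + C * (φ' z - b)) ^ 2 := by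
      filter_upwards [hev, hφ'.eventually_analyticAt] with z e1 e2
      have e3 := e2.differentiableAt.hasDerivAt
      refine (((((e3.sub_const b).const_mul A).div
        (((e3.sub_const b).const_mul C).const_add 1) e1).const_add c).deriv).trans ?_
      field_simp
      ring
    have hs : AnalyticAt ℂ (χ - φ) p := hχ.sub hφ
    have e0 : ∀ᶠ z in 𝓝 p, deriv (χ - φ) z =
        A * deriv φ' z / (1 + C * (φ' z - b)) ^ 2 - deriv φ z := by
      filter_upwards [hdχ, hχ.eventually_analyticAt, hφ.eventually_analyticAt] with z e1 e2 e3
      rw [deriv_sub e2.differentiableAt e3.differentiableAt, e1]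
    have v0 : (χ - φ) p = 0 := by simp [χ, hb, hc]
    have v1 : deriv (χ - φ) p = 0 := by
      rw [e0.self_of_nhds, ← hb, sub_self, hA]
      field_simp
      simp
    have v2 : deriv (deriv (χ - φ)) p = 0 := by
      rw [Filter.EventuallyEq.deriv_eq e0]
      have e3 := hφ'.differentiableAt.hasDerivAt
      have e4 := hφ'.deriv.differentiableAt.hasDerivAt
      have e5 := hφ.deriv.differentiableAt.hasDerivAt
      refine ((((e4.const_mul A).div ((((e3.sub_const b).const_mul C).const_add 1).pow 2)
        (pow_ne_zero 2 hden0)).sub e5).deriv).trans ?_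
      simp only [Pi.pow_apply]
      rw [← hb, sub_self, hC]
      field_simp
      simp
      field_simp
      ring
    show ((3 : ℕ) : ℕ∞) ≤ _
    rw [natCast_le_analyticOrderAt_iff_iteratedDeriv_eq_zero hs]
    intro i hi
    interval_cases i
    · rw [iteratedDeriv_zero, v0]
    · rw [iteratedDeriv_one, v1]
    · rw [iteratedDeriv_succ, iteratedDeriv_one, v2]

end GermLemmas

/-! ### Schwarzian differences of germs on the surface. -/

section SchwarzianGerms

universe u

variable {X : Type u} [TopologicalSpace X] [ChartedSpace ℂ X]

/-- In the preferred coordinate at `y`, the Schwarzian derivatives of `f₂` and `f₁` at `y` differ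
by `c`, whatever the affine coordinates. -/
def SchwarzianSub (f₁ f₂ : X → OnePoint ℂ) (y : X) (c : ℂ) : Prop :=
  ∀ g₁ φ₁ g₂ φ₂, AffineRep f₁ y g₁ φ₁ → AffineRep f₂ y g₂ φ₂ →
    c = schwarzian φ₂ (chartAt ℂ y y) - schwarzian φ₁ (chartAt ℂ y y)

lemma SchwarzianSub.of_affineRep {f₁ f₂ : X → OnePoint ℂ} {y : X} {g₁ g₂ : GL (Fin 2) ℂ}
    {φ₁ φ₂ : ℂ → ℂ} (h₁ : AffineRep f₁ y g₁ φ₁) (h₂ : AffineRep f₂ y g₂ φ₂)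
    (hd₁ : deriv φ₁ (chartAt ℂ y y) ≠ 0) (hd₂ : deriv φ₂ (chartAt ℂ y y) ≠ 0) :
    SchwarzianSub f₁ f₂ y (schwarzian φ₂ (chartAt ℂ y y) - schwarzian φ₁ (chartAt ℂ y y)) := by
  intro g₁' φ₁' g₂' φ₂' h₁' h₂'
  rw [h₁.schwarzian_eq h₁' hd₁, h₂.schwarzian_eq h₂' hd₂]

lemma SchwarzianSub.of_smul {f₁ f₂ f₁' f₂' : X → OnePoint ℂ} {y : X} {c : ℂ}
    {m₁ m₂ : GL (Fin 2) ℂ} (h : SchwarzianSub f₁ f₂ y c) (h₁ : ∀ᶠ w in 𝓝 y, f₁' w = m₁ • f₁ w)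
    (h₂ : ∀ᶠ w in 𝓝 y, f₂' w = m₂ • f₂ w) : SchwarzianSub f₁' f₂' y c :=
  fun _ _ _ _ r₁ r₂ => h _ _ _ _ (r₁.of_smul h₁) (r₂.of_smul h₂)

/-- Holomorphy supplies affine representations; without them `SchwarzianSub` holds vacuously for
every c. -/
lemma SchwarzianSub.unique {f₁ f₂ : X → OnePoint ℂ} {y : X} {c c' : ℂ}
    (h₁ : HolomorphicNear f₁ y) (h₂ : HolomorphicNear f₂ y) (h : SchwarzianSub f₁ f₂ y c)
    (h' : SchwarzianSub f₁ f₂ y c') : c = c' := by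
  obtain ⟨g₁, φ₁, r₁⟩ := h₁
  obtain ⟨g₂, φ₂, r₂⟩ := h₂
  rw [h _ _ _ _ r₁ r₂, h' _ _ _ _ r₁ r₂]

lemma SchwarzianSub.refl {f : X → OnePoint ℂ} {y : X} (h : RamifiedAt f y 0) :
    SchwarzianSub f f y 0 := by
  intro g₁ φ₁ g₂ φ₂ h₁ h₂
  rw [h₁.schwarzian_eq h₂ (h₁.deriv_ne_zero h), sub_self]

lemma SchwarzianSub.add {f₁ f₂ f₃ : X → OnePoint ℂ} {y : X} {c c' : ℂ}
    (hf : HolomorphicNear f₂ y) (h : SchwarzianSub f₁ f₂ y c) (h' : SchwarzianSub f₂ f₃ y c') :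
    SchwarzianSub f₁ f₃ y (c + c') := by
  intro g₁ φ₁ g₃ φ₃ r₁ r₃
  obtain ⟨g₂, φ₂, r₂⟩ := hf
  rw [h _ _ _ _ r₁ r₂, h' _ _ _ _ r₂ r₃]
  ring

lemma SchwarzianSub.neg {f₁ f₂ : X → OnePoint ℂ} {y : X} {c : ℂ} (h : SchwarzianSub f₁ f₂ y c) :
    SchwarzianSub f₂ f₁ y (-c) := by
  intro g₁ φ₁ g₂ φ₂ r₁ r₂
  rw [h _ _ _ _ r₂ r₁, neg_sub]

variable [IsManifold 𝓘(ℂ, ℂ) ω X]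

lemma schwarzian_sub_coordChange {x y : X} {φ₁ φ₂ : ℂ → ℂ} (hy : y ∈ (chartAt ℂ x).source)
    (h₁ : AnalyticAt ℂ φ₁ (chartAt ℂ x y)) (h₂ : AnalyticAt ℂ φ₂ (chartAt ℂ x y))
    (hd₁ : deriv φ₁ (chartAt ℂ x y) ≠ 0) (hd₂ : deriv φ₂ (chartAt ℂ x y) ≠ 0) :
    schwarzian (φ₂ ∘ coordChange x y) (chartAt ℂ y y) -
        schwarzian (φ₁ ∘ coordChange x y) (chartAt ℂ y y) =
      deriv (coordChange x y) (chartAt ℂ y y) ^ 2 *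
        (schwarzian φ₂ (chartAt ℂ x y) - schwarzian φ₁ (chartAt ℂ x y)) := by
  have hσ := analyticAt_coordChange x y (mem_chart_source ℂ y) hy
  have hσ0 := deriv_coordChange_ne_zero hy
  rw [← coordChange_apply x y] at h₁ h₂ hd₁ hd₂
  rw [schwarzian_comp hσ h₁ hσ0 hd₁, schwarzian_comp hσ h₂ hσ0 hd₂, coordChange_apply]
  ring

/-- Carries the computation in the chart at x over to the preferred chart of each nearby point.
Since u does not vanish, f₂ is unramified wherever f₁ is. -/
lemma Multiplier.eventually_schwarzianSub {f₁ f₂ : X → OnePoint ℂ} {x : X}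
    {g₁ g₂ : GL (Fin 2) ℂ} {φ₁ φ₂ u l : ℂ → ℂ} (h : Multiplier φ₁ φ₂ u l (chartAt ℂ x x))
    (r₁ : AffineRep f₁ x g₁ φ₁) (r₂ : AffineRep f₂ x g₂ φ₂) :
    ∀ᶠ y in 𝓝 x, RamifiedAt f₁ y 0 → RamifiedAt f₂ y 0 ∧ SchwarzianSub f₁ f₂ y
      (deriv (coordChange x y) (chartAt ℂ y y) ^ 2 * schwarzianDiff φ₁ l (chartAt ℂ x y)) := by
  filter_upwards [((chartAt ℂ x).continuousAt (mem_chart_source ℂ x)).eventually h.eventually,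
    r₁.eventually_at, r₂.eventually_at] with y hM ⟨hy, a₁, s₁⟩ ⟨_, a₂, s₂⟩ hram
  have hd₁' := s₁.deriv_ne_zero hram
  have hd₁ : deriv φ₁ (chartAt ℂ x y) ≠ 0 := by
    rw [deriv_comp_coordChange hy a₁] at hd₁'
    exact left_ne_zero_of_mul hd₁'
  have hd₂ : deriv φ₂ (chartAt ℂ x y) ≠ 0 := by
    rw [hM.deriv_eq.self_of_nhds]
    exact mul_ne_zero hM.u_ne hd₁
  have hd₂' : deriv (φ₂ ∘ coordChange x y) (chartAt ℂ y y) ≠ 0 := by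
    rw [deriv_comp_coordChange hy a₂]
    exact mul_ne_zero hd₂ (deriv_coordChange_ne_zero hy)
  refine ⟨s₂.ramifiedAt_zero hd₂', ?_⟩
  rw [← hM.schwarzian_sub hd₁, ← schwarzian_sub_coordChange hy a₁ a₂ hd₁ hd₂]
  exact .of_affineRep s₁ s₂ hd₁' hd₂'

/-- The difference of the Schwarzian derivatives of two germs with equivalent jets extends
holomorphically and vanishes to the ramification order. -/
lemma exists_schwarzianSub {f₁ f₂ : X → OnePoint ℂ} {x : X} {n : ℕ} {h₁ : RamifiedAt f₁ x n}
    {h₂ : RamifiedAt f₂ x n} (e : jetOrbit h₁ = jetOrbit h₂) :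
    ∃ Q : ℂ → ℂ, AnalyticAt ℂ Q (chartAt ℂ x x) ∧
      (n : ℕ∞) ≤ analyticOrderAt Q (chartAt ℂ x x) ∧
      ∀ᶠ y in 𝓝 x, RamifiedAt f₁ y 0 → SchwarzianSub f₁ f₂ y
        (deriv (coordChange x y) (chartAt ℂ y y) ^ 2 * Q (chartAt ℂ x y)) := by
  obtain ⟨g₁, φ₁, g₂, φ₂, r₁, r₂, hj⟩ := exists_affineReps_of_jetOrbit_eq e
  obtain ⟨u, l, hM, -, -⟩ := exists_multiplier r₁.1 r₂.1 (r₁.order_eq h₁) hj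
  exact ⟨schwarzianDiff φ₁ l, hM.analyticAt_schwarzianDiff,
    order_schwarzianDiff r₁.1 hM.an_l (r₁.order_eq h₁),
    (hM.eventually_schwarzianSub r₁ r₂).mono fun y hy hr => (hy hr).2⟩

/-- Germs with equivalent jets and the same Schwarzian derivative differ by a Möbius
transformation. -/
lemma exists_eventually_eq_smul {f₁ f₂ : X → OnePoint ℂ} {x : X} {n : ℕ} {h₁ : RamifiedAt f₁ x n}
    {h₂ : RamifiedAt f₂ x n} (e : jetOrbit h₁ = jetOrbit h₂)
    (h : ∀ᶠ y in 𝓝[≠] x, SchwarzianSub f₁ f₂ y 0) :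
    ∃ m : GL (Fin 2) ℂ, ∀ᶠ y in 𝓝 x, f₁ y = m • f₂ y := by
  obtain ⟨g₁, φ₁, g₂, φ₂, r₁, r₂, hj⟩ := exists_affineReps_of_jetOrbit_eq e
  have ho := r₁.order_eq h₁
  obtain ⟨u, l, hM, hu, hl⟩ := exists_multiplier r₁.1 r₂.1 ho hj
  have hv : φ₁ (chartAt ℂ x x) = φ₂ (chartAt ℂ x x) := by
    have : (φ₁ - φ₂) (chartAt ℂ x x) = 0 := by
      apply apply_eq_zero_of_analyticOrderAt_ne_zero
      intro h0; rw [h0] at hj; simp at hj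
    exact sub_eq_zero.1 this
  have hz : ∀ᶠ y in 𝓝[≠] x, schwarzianDiff φ₁ l (chartAt ℂ x y) = 0 := by
    filter_upwards [nhdsWithin_le_nhds (hM.eventually_schwarzianSub r₁ r₂), h,
      h₁.eventually_unramified, nhdsWithin_le_nhds r₁.eventually_at] with y e1 e2 e3 e4
    obtain ⟨e5, e6⟩ := e1 e3
    have := e6.unique e3.holomorphicNear e5.holomorphicNear e2
    exact (mul_eq_zero.1 this).resolve_left (pow_ne_zero 2 (deriv_coordChange_ne_zero e4.1))
  have hz' : ∀ᶠ z in 𝓝[≠] (chartAt ℂ x x), schwarzianDiff φ₁ l z = 0 := by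
    filter_upwards [(tendsto_chart_symm_punctured x).eventually hz,
      nhdsWithin_le_nhds (chart_right_inv_eventually x)] with z e1 e2
    rwa [e2] at e1
  have heq := eventually_eq_of_schwarzianDiff_eq_zero hM hu hl hv ho hz'
  refine ⟨g₁ * g₂⁻¹, ?_⟩
  filter_upwards [r₁.2, r₂.2,
    ((chartAt ℂ x).continuousAt (mem_chart_source ℂ x)).eventually heq] with y e1 e2 e3
  rw [e1, e2, e3, mul_smul, inv_smul_smul]

/-- A germ with the same jet as a given one and prescribed Schwarzian derivative. -/
lemma exists_germ_schwarzianSub {f₁ : X → OnePoint ℂ} {x : X} {n : ℕ} (h₁ : RamifiedAt f₁ x n)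
    {Q : ℂ → ℂ} (hQ : AnalyticAt ℂ Q (chartAt ℂ x x))
    (hQn : (n : ℕ∞) ≤ analyticOrderAt Q (chartAt ℂ x x)) :
    ∃ (f₂ : X → OnePoint ℂ) (h₂ : RamifiedAt f₂ x n), jetOrbit h₂ = jetOrbit h₁ ∧
      ∀ᶠ y in 𝓝 x, RamifiedAt f₁ y 0 → SchwarzianSub f₁ f₂ y
        (deriv (coordChange x y) (chartAt ℂ y y) ^ 2 * Q (chartAt ℂ x y)) := by
  obtain ⟨g, φ₁, r₁, ho⟩ := id h₁
  obtain ⟨φ₂, u, l, hM, hS, ho₂, hj⟩ := exists_prescribed_schwarzianDiff r₁.1 hQ ho hQn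
  have r₂ : AffineRep (fun y => g • (φ₂ (chartAt ℂ x y) : OnePoint ℂ)) x g φ₂ :=
    ⟨hM.an₂, .of_forall fun _ => rfl⟩
  have h₂ : RamifiedAt (fun y => g • (φ₂ (chartAt ℂ x y) : OnePoint ℂ)) x n := ⟨g, φ₂, r₂, ho₂⟩
  refine ⟨_, h₂, ?_, ?_⟩
  · rw [jetOrbit_eq_iff]
    refine ⟨1, g, φ₁, φ₂, ?_, r₂, hj⟩
    rwa [one_smul]
  · filter_upwards [hM.eventually_schwarzianSub r₁ r₂,
      ((chartAt ℂ x).continuousAt (mem_chart_source ℂ x)).eventually hS] with y e1 e2 hr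
    rw [← e2]
    exact (e1 hr).2

end SchwarzianGerms

/-! ### Branched structures with a given class, and their differences. -/

section Structures

universe u

lemma eventually_divisor_eq_zero {X : Type u} [TopologicalSpace X] [T2Space X] (D : EffectiveDivisor X) (x : X) :
    ∀ᶠ y in 𝓝[≠] x, D y = 0 := by
  obtain ⟨t, ht, hfin⟩ := D.supportLocallyFiniteWithinDomain' x trivial
  have h1 : ((t ∩ Function.support D) \ {x})ᶜ ∈ 𝓝 x :=
    (hfin.subset Set.sdiff_subset).isClosed.isOpen_compl.mem_nhds (by simp)
  filter_upwards [self_mem_nhdsWithin, nhdsWithin_le_nhds h1, nhdsWithin_le_nhds ht]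
    with y hy h2 h3
  by_contra h0
  exact h2 ⟨⟨h3, h0⟩, hy⟩

variable {X : Type u} [TopologicalSpace X] [ChartedSpace ℂ X] {D : EffectiveDivisor X}

/-- The germ of `f` at `x` is a ramified covering in the class `a`. -/
def HasOrbit (a : BranchingClass D) (f : X → OnePoint ℂ) (x : X) : Prop :=
  ∃ h : RamifiedAt f x (D x), jetOrbit h = a x

lemma exists_hasOrbit (a : BranchingClass D) (x : X) : ∃ f, HasOrbit a f x := by
  obtain ⟨j, hj⟩ := Quotient.exists_rep (a x)
  obtain ⟨f, hf⟩ := Quotient.exists_rep j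
  exact ⟨f.1, f.2, by rw [← hj, ← hf]; rfl⟩

lemma HasOrbit.smul {a : BranchingClass D} {f f' : X → OnePoint ℂ} {x : X} {m : GL (Fin 2) ℂ}
    (h : HasOrbit a f x) (hf : ∀ᶠ y in 𝓝 x, f' y = m • f y) : HasOrbit a f' x := by
  obtain ⟨h1, h2⟩ := h
  exact ⟨h1.of_eventually_smul hf, by rw [jetOrbit_eq_of_smul h1 _ hf, h2]⟩

lemma jetOrbit_eq_of_eq_zero {f f' : X → OnePoint ℂ} {x : X} {n : ℕ} (hn : n = 0)
    (h : RamifiedAt f x n) (h' : RamifiedAt f' x n) : jetOrbit h = jetOrbit h' := by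
  subst hn
  exact jetOrbit_zero_eq h h'

/-- Transitivity on 2-jets: off the support of D there is only one orbit, so the class imposes
nothing beyond being unramified. -/
lemma RamifiedAt.hasOrbit {f : X → OnePoint ℂ} {x : X} (h : RamifiedAt f x 0) (hD : D x = 0)
    (a : BranchingClass D) : HasOrbit a f x := by
  obtain ⟨f', h1, h2⟩ := exists_hasOrbit a x
  have h' : RamifiedAt f x (D x) := by rwa [hD]
  exact ⟨h', by rw [← h2]; exact jetOrbit_eq_of_eq_zero hD _ _⟩

lemma HasOrbit.ramifiedAt_zero {a : BranchingClass D} {f : X → OnePoint ℂ} {x : X}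
    (h : HasOrbit a f x) (hD : D x = 0) : RamifiedAt f x 0 := by
  obtain ⟨h1, -⟩ := h
  rwa [hD] at h1

lemma HasOrbit.holomorphicNear {a : BranchingClass D} {f : X → OnePoint ℂ} {x : X}
    (h : HasOrbit a f x) : HolomorphicNear f x := by
  obtain ⟨h1, -⟩ := h
  exact h1.holomorphicNear

/-- A condition at the single point x spreads to a neighbourhood: at nearby points other than x the
map is unramified and D is zero, where the class is automatic. -/
lemma HasOrbit.exists_chart [T2Space X] [IsManifold 𝓘(ℂ, ℂ) ω X] {a : BranchingClass D}
    {f : X → OnePoint ℂ} {x : X} (h : HasOrbit a f x) {P : X → Prop} (hP : ∀ᶠ y in 𝓝 x, P y) :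
    ∃ c : BranchedChart X, c.toFun = f ∧ x ∈ c.carrier ∧
      ∀ y ∈ c.carrier, P y ∧ HasOrbit a f y := by
  have ho : ∀ᶠ y in 𝓝 x, HasOrbit a f y := by
    have : ∀ᶠ y in 𝓝[≠] x, HasOrbit a f y := by
      obtain ⟨h1, -⟩ := h
      filter_upwards [h1.eventually_unramified, eventually_divisor_eq_zero D x] with y e1 e2
      exact e1.hasOrbit e2 a
    rw [eventually_nhdsWithin_iff] at this
    filter_upwards [this] with y hy
    by_cases hyx : y = x
    · rwa [hyx]
    · exact hy hyx
  obtain ⟨s, hs, hso, hxs⟩ := mem_nhds_iff.1 (hP.and ho)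
  refine ⟨⟨⟨s, hso⟩, f, fun y hy => (hs hy).2.holomorphicNear, fun y hy => ?_⟩, rfl, hxs,
    fun y hy => hs hy⟩
  obtain ⟨h1, -⟩ := (hs hy).2
  exact h1.not_eventually_const

/-! ### Charts of structures -/

lemma BranchedStructure.IsChart.le {U : Opens X} {p : BranchedStructure U} {c : BranchedChart X}
    (h : p.IsChart c) : c.carrier ≤ U := by
  obtain ⟨A, -, hc⟩ := h
  exact A.2.le c hc

lemma BranchedStructure.IsChart.compatible {U : Opens X} {p : BranchedStructure U}
    {c c' : BranchedChart X} (h : p.IsChart c) (h' : p.IsChart c') : c.Compatible c' := by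
  obtain ⟨A, hA, hc⟩ := h
  obtain ⟨B, hB, hc'⟩ := h'
  have : IsBranchedAtlas U (A.1 ∪ B.1) := Quotient.exact (hA.trans hB.symm)
  exact this.compatible c (Or.inl hc) c' (Or.inr hc')

lemma BranchedStructure.exists_isChart {U : Opens X} (p : BranchedStructure U) {x : X}
    (hx : x ∈ U) : ∃ c, p.IsChart c ∧ x ∈ c.carrier := by
  obtain ⟨A, hA⟩ := Quotient.exists_rep p
  obtain ⟨c, hc, hxc⟩ := A.2.cover x hx
  exact ⟨c, ⟨A, hA, hc⟩, hxc⟩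

lemma BranchedStructure.eq_of_compatible {U : Opens X} {p p' : BranchedStructure U}
    (h : ∀ c c', p.IsChart c → p'.IsChart c' → c.Compatible c') : p = p' := by
  obtain ⟨A, rfl⟩ := Quotient.exists_rep p
  obtain ⟨B, rfl⟩ := Quotient.exists_rep p'
  apply Quotient.sound
  have key : ∀ c ∈ A.1, ∀ c' ∈ B.1, c.Compatible c' := fun c hc c' hc' =>
    h c c' ⟨A, rfl, hc⟩ ⟨B, rfl, hc'⟩
  refine ⟨?_, ?_, ?_⟩
  · rintro c (hc | hc)
    exacts [A.2.le c hc, B.2.le c hc]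
  · intro x hx
    obtain ⟨c, hc, hxc⟩ := A.2.cover x hx
    exact ⟨c, Or.inl hc, hxc⟩
  · rintro c (hc | hc) c' (hc' | hc')
    exacts [A.2.compatible c hc c' hc', key c hc c' hc', (key c' hc' c hc).symm,
      B.2.compatible c hc c' hc']

lemma StructuresWithClass.hasOrbit {a : BranchingClass D} {U : Opens X}
    (p : StructuresWithClass a U) {c : BranchedChart X} (hc : p.1.IsChart c) {x : X}
    (hx : x ∈ c.carrier) : HasOrbit a c.toFun x :=
  p.2 c hc x hx

/-- `HasClass` concerns the charts of all equivalent atlases. Near each point these are Möbius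
images of charts in A, and orbits are Möbius invariant, so checking A suffices. -/
lemma exists_structure {a : BranchingClass D} {U : Opens X} {A : Set (BranchedChart X)}
    (hA : IsBranchedAtlas U A) (ha : ∀ c ∈ A, ∀ x ∈ c.carrier, HasOrbit a c.toFun x) :
    ∃ p : StructuresWithClass a U, ∀ c ∈ A, p.1.IsChart c := by
  have hch : ∀ c ∈ A, BranchedStructure.IsChart (U := U)
      (Quotient.mk (atlasSetoid U) ⟨A, hA⟩) c := fun c hc => ⟨⟨A, hA⟩, rfl, hc⟩
  refine ⟨⟨Quotient.mk (atlasSetoid U) ⟨A, hA⟩, ?_⟩, hch⟩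
  intro c hc x hx
  obtain ⟨c', hc', hx'⟩ := hA.cover x (hc.le hx)
  obtain ⟨m, hm⟩ := hc.compatible (hch c' hc') x hx hx'
  exact (ha c' hc' x hx').smul hm

/-! ### Differences -/

variable {a : BranchingClass D} {U₁ U₂ U₃ W : Opens X}

/-- By Möbius invariance of Schwarzian differences, one pair of charts at each point decides for all
pairs. -/
lemma isDifference_iff (p₁ : StructuresWithClass a U₁) (p₂ : StructuresWithClass a U₂)
    (q : QuadDiff D W) : IsDifference p₁ p₂ q ↔ W ≤ U₁ ∧ W ≤ U₂ ∧ ∀ x ∈ W, D x = 0 →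
      ∃ c₁ c₂, p₁.1.IsChart c₁ ∧ p₂.1.IsChart c₂ ∧ x ∈ c₁.carrier ∧ x ∈ c₂.carrier ∧
        SchwarzianSub c₁.toFun c₂.toFun x (coeff q.1 (chartAt ℂ x) (chartAt ℂ x x)) := by
  constructor
  · rintro ⟨h1, h2, h⟩
    refine ⟨h1, h2, fun x hx hD => ?_⟩
    obtain ⟨c₁, hc₁, hx₁⟩ := p₁.1.exists_isChart (h1 hx)
    obtain ⟨c₂, hc₂, hx₂⟩ := p₂.1.exists_isChart (h2 hx)
    exact ⟨c₁, c₂, hc₁, hc₂, hx₁, hx₂, h x hx hD c₁ c₂ hc₁ hc₂ hx₁ hx₂⟩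
  · rintro ⟨h1, h2, h⟩
    refine ⟨h1, h2, fun x hx hD c₁ c₂ hc₁ hc₂ hx₁ hx₂ => ?_⟩
    obtain ⟨d₁, d₂, hd₁, hd₂, hy₁, hy₂, hs⟩ := h x hx hD
    obtain ⟨m₁, hm₁⟩ := hc₁.compatible hd₁ x hx₁ hy₁
    obtain ⟨m₂, hm₂⟩ := hc₂.compatible hd₂ x hx₂ hy₂
    exact hs.of_smul hm₁ hm₂

lemma IsDifference.schwarzianSub {p₁ : StructuresWithClass a U₁} {p₂ : StructuresWithClass a U₂}
    {q : QuadDiff D W} (h : IsDifference p₁ p₂ q) {x : X} (hx : x ∈ W) (hD : D x = 0)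
    {c₁ c₂ : BranchedChart X} (hc₁ : p₁.1.IsChart c₁) (hc₂ : p₂.1.IsChart c₂)
    (hx₁ : x ∈ c₁.carrier) (hx₂ : x ∈ c₂.carrier) :
    SchwarzianSub c₁.toFun c₂.toFun x (coeff q.1 (chartAt ℂ x) (chartAt ℂ x x)) :=
  h.2.2 x hx hD c₁ c₂ hc₁ hc₂ hx₁ hx₂

lemma IsDifference.refl (p : StructuresWithClass a U₁) (h : W ≤ U₁) :
    IsDifference p p (0 : QuadDiff D W) := by
  rw [isDifference_iff]
  refine ⟨h, h, fun x hx hD => ?_⟩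
  obtain ⟨c, hc, hxc⟩ := p.1.exists_isChart (h hx)
  refine ⟨c, c, hc, hc, hxc, hxc, ?_⟩
  have : coeff (0 : QuadDiff D W).1 (chartAt ℂ x) (chartAt ℂ x x) = 0 := by simp [coeff]
  rw [this]
  exact .refl ((p.hasOrbit hc hxc).ramifiedAt_zero hD)

lemma IsDifference.add {p₁ : StructuresWithClass a U₁} {p₂ : StructuresWithClass a U₂}
    {p₃ : StructuresWithClass a U₃} {q r : QuadDiff D W} (h : IsDifference p₁ p₂ q)
    (h' : IsDifference p₂ p₃ r) : IsDifference p₁ p₃ (q + r) := by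
  rw [isDifference_iff]
  refine ⟨h.1, h'.2.1, fun x hx hD => ?_⟩
  obtain ⟨c₁, hc₁, hx₁⟩ := p₁.1.exists_isChart (h.1 hx)
  obtain ⟨c₂, hc₂, hx₂⟩ := p₂.1.exists_isChart (h.2.1 hx)
  obtain ⟨c₃, hc₃, hx₃⟩ := p₃.1.exists_isChart (h'.2.1 hx)
  refine ⟨c₁, c₃, hc₁, hc₃, hx₁, hx₃, ?_⟩
  have : coeff (q + r).1 (chartAt ℂ x) (chartAt ℂ x x) =
      coeff q.1 (chartAt ℂ x) (chartAt ℂ x x) + coeff r.1 (chartAt ℂ x) (chartAt ℂ x x) :=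
    congrFun (coeff_add q.1 r.1 (chartAt ℂ x)) _
  rw [this]
  exact (h.schwarzianSub hx hD hc₁ hc₂ hx₁ hx₂).add (p₂.hasOrbit hc₂ hx₂).holomorphicNear
    (h'.schwarzianSub hx hD hc₂ hc₃ hx₂ hx₃)

lemma IsDifference.symm {p₁ : StructuresWithClass a U₁} {p₂ : StructuresWithClass a U₂}
    {q : QuadDiff D W} (h : IsDifference p₁ p₂ q) : IsDifference p₂ p₁ (-q) := by
  rw [isDifference_iff]
  refine ⟨h.2.1, h.1, fun x hx hD => ?_⟩
  obtain ⟨c₁, hc₁, hx₁⟩ := p₁.1.exists_isChart (h.1 hx)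
  obtain ⟨c₂, hc₂, hx₂⟩ := p₂.1.exists_isChart (h.2.1 hx)
  refine ⟨c₂, c₁, hc₂, hc₁, hx₂, hx₁, ?_⟩
  have : coeff (-q).1 (chartAt ℂ x) (chartAt ℂ x x) =
      -coeff q.1 (chartAt ℂ x) (chartAt ℂ x x) := by
    rw [show (-q).1 = (-1 : ℂ) • q.1 from (neg_one_smul ℂ q.1).symm, coeff_smul]
    simp
  rw [this]
  exact (h.schwarzianSub hx hD hc₁ hc₂ hx₁ hx₂).neg

lemma IsDifference.res {p₁ : StructuresWithClass a U₁} {p₂ : StructuresWithClass a U₂}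
    {q : QuadDiff D W} (h : IsDifference p₁ p₂ q) {V : Opens X} (hV : V ≤ W) :
    IsDifference p₁ p₂ (QuadDiff.res D hV q) := by
  refine ⟨hV.trans h.1, hV.trans h.2.1, fun x hx => ?_⟩
  rw [show coeff (QuadDiff.res D hV q).1 (chartAt ℂ x) (chartAt ℂ x x) = _ from
    (coeff_res_eventuallyEq hV q.1 hx).self_of_nhds]
  exact h.2.2 x (hV hx)

variable [T2Space X] [IsManifold 𝓘(ℂ, ℂ) ω X]

lemma exists_local_structure (a : BranchingClass D) (x : X) :
    ∃ U : Opens X, x ∈ U ∧ Nonempty (StructuresWithClass a U) := by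
  obtain ⟨f, hf⟩ := exists_hasOrbit a x
  obtain ⟨c, hcf, hxc, hc⟩ := hf.exists_chart (P := fun _ => True) (.of_forall fun _ => trivial)
  have hA : IsBranchedAtlas c.carrier {c} := by
    refine ⟨?_, fun y hy => ⟨c, rfl, hy⟩, ?_⟩
    · rintro _ rfl
      exact le_rfl
    · rintro _ rfl _ rfl y _ _
      exact ⟨1, .of_forall fun _ => (one_smul _ _).symm⟩
  obtain ⟨p, -⟩ := exists_structure (a := a) hA (by
    rintro _ rfl y hy
    rw [hcf]
    exact (hc y hy).2)
  exact ⟨c.carrier, hxc, ⟨p⟩⟩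

/-- The support of D is discrete and the coefficients are analytic, so the identity theorem extends
the equality across it. -/
lemma QuadDiff.ext_of_coeff {q r : QuadDiff D W}
    (h : ∀ x ∈ W, D x = 0 → coeff q.1 (chartAt ℂ x) (chartAt ℂ x x) =
      coeff r.1 (chartAt ℂ x) (chartAt ℂ x x)) : q = r := by
  have key : ∀ x ∈ W, coeff q.1 (chartAt ℂ x) (chartAt ℂ x x) =
      coeff r.1 (chartAt ℂ x) (chartAt ℂ x x) := by
    intro x hx
    have h1 : ∀ᶠ y in 𝓝[≠] x, coeff q.1 (chartAt ℂ x) (chartAt ℂ x y) =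
        coeff r.1 (chartAt ℂ x) (chartAt ℂ x y) := by
      filter_upwards [eventually_divisor_eq_zero D x,
        nhdsWithin_le_nhds (W.isOpen.mem_nhds hx),
        nhdsWithin_le_nhds ((chartAt ℂ x).open_source.mem_nhds (mem_chart_source ℂ x))]
        with y e1 e2 e3
      have := h y e2 e1
      rw [coeff_self_eq q.1 e2 e3, coeff_self_eq r.1 e2 e3] at this
      exact mul_left_cancel₀ (pow_ne_zero 2 (deriv_coordChange_ne_zero e3)) this
    refine (eventually_of_punctured (q.2 x hx).1 (r.2 x hx).1 ?_).self_of_nhds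
    filter_upwards [(tendsto_chart_symm_punctured x).eventually h1,
      nhdsWithin_le_nhds (chart_right_inv_eventually x)] with z e1 e2
    rwa [e2] at e1
  apply Subtype.ext
  funext ⟨x, hx⟩
  have h1 := key x hx
  rw [coeff_self q.1 hx, coeff_self r.1 hx] at h1
  have ext : ∀ B C : ℂ →ₗ[ℂ] ℂ →ₗ[ℂ] ℂ, B 1 1 = C 1 1 → B = C := fun B C h =>
    LinearMap.ext_ring (LinearMap.ext_ring h)
  exact ext _ _ h1

lemma IsDifference.unique {p₁ : StructuresWithClass a U₁} {p₂ : StructuresWithClass a U₂}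
    {q r : QuadDiff D W} (h : IsDifference p₁ p₂ q) (h' : IsDifference p₁ p₂ r) : q = r := by
  refine QuadDiff.ext_of_coeff fun x hx hD => ?_
  obtain ⟨c₁, hc₁, hx₁⟩ := p₁.1.exists_isChart (h.1 hx)
  obtain ⟨c₂, hc₂, hx₂⟩ := p₂.1.exists_isChart (h.2.1 hx)
  exact (h.schwarzianSub hx hD hc₁ hc₂ hx₁ hx₂).unique (p₁.hasOrbit hc₁ hx₁).holomorphicNear
    (p₂.hasOrbit hc₂ hx₂).holomorphicNear (h'.schwarzianSub hx hD hc₁ hc₂ hx₁ hx₂)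

/-- The difference of two structures with the same branching class exists. -/
lemma exists_isDifference (p₁ : StructuresWithClass a U₁) (p₂ : StructuresWithClass a U₂)
    (h₁ : W ≤ U₁) (h₂ : W ≤ U₂) : ∃ q : QuadDiff D W, IsDifference p₁ p₂ q := by
  have hloc : ∀ x : W, ∃ (c₁ c₂ : BranchedChart X) (Q : ℂ → ℂ), p₁.1.IsChart c₁ ∧
      p₂.1.IsChart c₂ ∧ (x : X) ∈ c₁.carrier ∧ (x : X) ∈ c₂.carrier ∧
      AnalyticAt ℂ Q (chartAt ℂ (x : X) x) ∧
      (D x : ℕ∞) ≤ analyticOrderAt Q (chartAt ℂ (x : X) x) ∧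
      ∀ᶠ y in 𝓝 (x : X), RamifiedAt c₁.toFun y 0 → SchwarzianSub c₁.toFun c₂.toFun y
        (deriv (coordChange (x : X) y) (chartAt ℂ y y) ^ 2 * Q (chartAt ℂ (x : X) y)) := by
    rintro ⟨x, hx⟩
    obtain ⟨c₁, hc₁, hx₁⟩ := p₁.1.exists_isChart (h₁ hx)
    obtain ⟨c₂, hc₂, hx₂⟩ := p₂.1.exists_isChart (h₂ hx)
    obtain ⟨r₁, e₁⟩ := p₁.hasOrbit hc₁ hx₁
    obtain ⟨r₂, e₂⟩ := p₂.hasOrbit hc₂ hx₂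
    obtain ⟨Q, hQ⟩ := exists_schwarzianSub (e₁.trans e₂.symm)
    exact ⟨c₁, c₂, Q, hc₁, hc₂, hx₁, hx₂, hQ⟩
  choose c₁ c₂ Q hc₁ hc₂ hx₁ hx₂ hQ hQo hS using hloc
  -- The differential is defined pointwise, from the local extension centred at each point evaluated
  -- at that point; its regularity comes from `hcoeff`.
  let B : W → ℂ →ₗ[ℂ] ℂ →ₗ[ℂ] ℂ := fun x => Q x (chartAt ℂ (x : X) x) • LinearMap.mul ℂ ℂ
  have hB : ∀ x, B x 1 1 = Q x (chartAt ℂ (x : X) x) := fun x => by simp [B]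
  let q : RoughQuadDiff W := B
  have hself : ∀ x (hx : x ∈ W), coeff q (chartAt ℂ x) (chartAt ℂ x x) =
      Q ⟨x, hx⟩ (chartAt ℂ x x) := fun x hx => (coeff_self q hx).trans (hB ⟨x, hx⟩)
  have hSself : ∀ x (hx : x ∈ W), D x = 0 → SchwarzianSub (c₁ ⟨x, hx⟩).toFun (c₂ ⟨x, hx⟩).toFun x
      (coeff q (chartAt ℂ x) (chartAt ℂ x x)) := by
    intro x hx hD
    have := (hS ⟨x, hx⟩).self_of_nhds ((p₁.hasOrbit (hc₁ _) (hx₁ _)).ramifiedAt_zero hD)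
    have hd := deriv_coordChange_mul x x (mem_chart_source ℂ x) (mem_chart_source ℂ x)
    rw [sq, hd, one_mul] at this
    rw [hself x hx]
    exact this
  -- At a nearby y off the support, the charts chosen at x and those chosen at y compute the same
  -- Schwarzian difference, so the pointwise values fit together into the analytic function `Q` at
  -- x.
  have hcoeff : ∀ x (hx : x ∈ W), coeff q (chartAt ℂ x) =ᶠ[𝓝 (chartAt ℂ x x)] Q ⟨x, hx⟩ := by
    intro x hx
    have h1 : ∀ᶠ y in 𝓝[≠] x, coeff q (chartAt ℂ x) (chartAt ℂ x y) =
        Q ⟨x, hx⟩ (chartAt ℂ x y) := by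
      filter_upwards [eventually_divisor_eq_zero D x, nhdsWithin_le_nhds (W.isOpen.mem_nhds hx),
        nhdsWithin_le_nhds ((chartAt ℂ x).open_source.mem_nhds (mem_chart_source ℂ x)),
        nhdsWithin_le_nhds (hS ⟨x, hx⟩),
        nhdsWithin_le_nhds ((c₁ ⟨x, hx⟩).carrier.isOpen.mem_nhds (hx₁ ⟨x, hx⟩)),
        nhdsWithin_le_nhds ((c₂ ⟨x, hx⟩).carrier.isOpen.mem_nhds (hx₂ ⟨x, hx⟩))]
        with y hD hy hys hSy hy₁ hy₂
      have o₁ := p₁.hasOrbit (hc₁ ⟨x, hx⟩) hy₁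
      have o₂ := p₂.hasOrbit (hc₂ ⟨x, hx⟩) hy₂
      have s₁ := hSy (o₁.ramifiedAt_zero hD)
      obtain ⟨m₁, hm₁⟩ := (hc₁ ⟨x, hx⟩).compatible (hc₁ ⟨y, hy⟩) y hy₁ (hx₁ ⟨y, hy⟩)
      obtain ⟨m₂, hm₂⟩ := (hc₂ ⟨x, hx⟩).compatible (hc₂ ⟨y, hy⟩) y hy₂ (hx₂ ⟨y, hy⟩)
      have s₂ := (hSself y hy hD).of_smul hm₁ hm₂
      have := s₂.unique o₁.holomorphicNear o₂.holomorphicNear s₁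
      rw [coeff_self_eq q hy hys] at this
      exact mul_left_cancel₀ (pow_ne_zero 2 (deriv_coordChange_ne_zero hys)) this
    have h2 : ∀ᶠ z in 𝓝[≠] (chartAt ℂ x x), coeff q (chartAt ℂ x) z = Q ⟨x, hx⟩ z := by
      filter_upwards [(tendsto_chart_symm_punctured x).eventually h1,
        nhdsWithin_le_nhds (chart_right_inv_eventually x)] with z e1 e2
      rwa [e2] at e1
    rw [eventually_nhdsWithin_iff] at h2
    filter_upwards [h2] with z hz
    by_cases hzx : z = chartAt ℂ x x
    · rw [hzx]
      exact hself x hx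
    · exact hz hzx
  refine ⟨⟨q, fun x hx => ⟨(hQ ⟨x, hx⟩).congr (hcoeff x hx).symm, ?_⟩⟩, ?_⟩
  · rw [analyticOrderAt_congr (hcoeff x hx)]
    exact hQo ⟨x, hx⟩
  · rw [isDifference_iff]
    exact ⟨h₁, h₂, fun x hx hD => ⟨_, _, hc₁ ⟨x, hx⟩, hc₂ ⟨x, hx⟩, hx₁ ⟨x, hx⟩, hx₂ ⟨x, hx⟩,
      hSself x hx hD⟩⟩

lemma HasOrbit.exists_eventually_eq_smul {f f' : X → OnePoint ℂ} {x : X} (h : HasOrbit a f x)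
    (h' : HasOrbit a f' x) (hs : ∀ᶠ y in 𝓝 x, D y = 0 → SchwarzianSub f f' y 0) :
    ∃ m : GL (Fin 2) ℂ, ∀ᶠ y in 𝓝 x, f y = m • f' y := by
  obtain ⟨h1, e1⟩ := h
  obtain ⟨h2, e2⟩ := h'
  refine BranchedProj.exists_eventually_eq_smul (e1.trans e2.symm) ?_
  filter_upwards [eventually_divisor_eq_zero D x, nhdsWithin_le_nhds hs] with y hD hy
  exact hy hD

lemma IsDifference.compatible {p₁ : StructuresWithClass a U₁} {p₂ : StructuresWithClass a U₂}
    (h : IsDifference p₁ p₂ (0 : QuadDiff D W)) {c₁ c₂ : BranchedChart X}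
    (hc₁ : p₁.1.IsChart c₁) (hc₂ : p₂.1.IsChart c₂) {x : X} (hx : x ∈ W) (hx₁ : x ∈ c₁.carrier)
    (hx₂ : x ∈ c₂.carrier) :
    ∃ m : GL (Fin 2) ℂ, ∀ᶠ y in 𝓝 x, c₁.toFun y = m • c₂.toFun y := by
  refine (p₁.hasOrbit hc₁ hx₁).exists_eventually_eq_smul (p₂.hasOrbit hc₂ hx₂) ?_
  filter_upwards [W.isOpen.mem_nhds hx, c₁.carrier.isOpen.mem_nhds hx₁,
    c₂.carrier.isOpen.mem_nhds hx₂] with y hy hy₁ hy₂ hD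
  have := h.schwarzianSub hy hD hc₁ hc₂ hy₁ hy₂
  rwa [show coeff (0 : QuadDiff D W).1 (chartAt ℂ y) (chartAt ℂ y y) = 0 by simp [coeff]] at this

lemma IsDifference.eq {p₁ p₂ : StructuresWithClass a W}
    (h : IsDifference p₁ p₂ (0 : QuadDiff D W)) : p₁ = p₂ :=
  Subtype.ext (BranchedStructure.eq_of_compatible fun _ _ hc hc' _ hx hx' =>
    h.compatible hc hc' (hc.le hx) hx hx')

/-- A structure can be translated by any quadratic differential vanishing over `D`. -/
lemma exists_translate (p : StructuresWithClass a U₁) (hW : W ≤ U₁) (q : QuadDiff D W) :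
    ∃ p' : StructuresWithClass a W, IsDifference p p' q := by
  -- All charts of the right class with the prescribed difference from p are taken at once. Any two
  -- have Schwarzian difference zero off the support, so they are compatible without further choice.
  let A : Set (BranchedChart X) := {c | c.carrier ≤ W ∧ (∀ x ∈ c.carrier, HasOrbit a c.toFun x) ∧
    ∀ x ∈ c.carrier, D x = 0 → ∃ c₁, p.1.IsChart c₁ ∧ x ∈ c₁.carrier ∧
      SchwarzianSub c₁.toFun c.toFun x (coeff q.1 (chartAt ℂ x) (chartAt ℂ x x))}
  have hcover : ∀ x ∈ W, ∃ c ∈ A, x ∈ c.carrier := by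
    intro x hx
    obtain ⟨c₁, hc₁, hx₁⟩ := p.1.exists_isChart (hW hx)
    obtain ⟨r₁, e₁⟩ := p.hasOrbit hc₁ hx₁
    obtain ⟨f, hf, ef, hS⟩ := exists_germ_schwarzianSub r₁ (q.2 x hx).1 (q.2 x hx).2
    obtain ⟨c, rfl, hxc, hc⟩ := HasOrbit.exists_chart (a := a) ⟨hf, ef.trans e₁⟩
      (hS.and ((W.isOpen.eventually_mem hx).and ((c₁.carrier.isOpen.eventually_mem hx₁).and
        ((chartAt ℂ x).open_source.eventually_mem (mem_chart_source ℂ x)))))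
    refine ⟨c, ⟨fun y hy => (hc y hy).1.2.1, fun y hy => (hc y hy).2, fun y hy hD => ?_⟩, hxc⟩
    obtain ⟨hSy, hyW, hy₁, hys⟩ := (hc y hy).1
    refine ⟨c₁, hc₁, hy₁, ?_⟩
    rw [coeff_self_eq q.1 hyW hys]
    exact hSy ((p.hasOrbit hc₁ hy₁).ramifiedAt_zero hD)
  have hA : IsBranchedAtlas W A := by
    refine ⟨fun c hc => hc.1, hcover, fun c hc c' hc' x hx hx' => ?_⟩
    refine (hc.2.1 x hx).exists_eventually_eq_smul (hc'.2.1 x hx') ?_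
    filter_upwards [c.carrier.isOpen.eventually_mem hx, c'.carrier.isOpen.eventually_mem hx']
      with y hy hy' hD
    obtain ⟨d, hd, hyd, hs⟩ := hc.2.2 y hy hD
    obtain ⟨d', hd', hyd', hs'⟩ := hc'.2.2 y hy' hD
    obtain ⟨m, hm⟩ := hd.compatible hd' y hyd hyd'
    have hs'' := hs'.of_smul (m₂ := 1) hm (.of_forall fun _ => (one_smul _ _).symm)
    have := hs.neg.add (p.hasOrbit hd hyd).holomorphicNear hs''
    rwa [neg_add_cancel] at this
  obtain ⟨p', hp'⟩ := exists_structure hA fun c hc => hc.2.1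
  refine ⟨p', (isDifference_iff _ _ _).2 ⟨hW, le_rfl, fun x hx hD => ?_⟩⟩
  obtain ⟨c, hc, hxc⟩ := hcover x hx
  obtain ⟨c₁, hc₁, hx₁, hs⟩ := hc.2.2 x hxc hD
  exact ⟨c₁, c, hc₁, hp' c hc, hx₁, hxc, hs⟩

end Structures

/-! ### The obstruction class and the affine structure. -/

section Obstruction

universe u

lemma Cocycle.toH1_refine {X : Type u} [TopologicalSpace X] [ChartedSpace ℂ X]
    {D : EffectiveDivisor X} {𝒰 𝒱 : PointedCover X} (h : 𝒰 ≤ 𝒱) (s : Cocycle D 𝒰) :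
    Cocycle.toH1 D 𝒱 (Cocycle.refine D h s) = Cocycle.toH1 D 𝒰 s :=
  Module.DirectLimit.of_f (R := ℂ) (G := CoverH1 D) (f := CoverH1.refine D) (hij := h)
    (x := Submodule.Quotient.mk s)

variable {X : Type u} [TopologicalSpace X] [T2Space X] [ChartedSpace ℂ X]
  [IsManifold 𝓘(ℂ, ℂ) ω X] {D : EffectiveDivisor X} {a : BranchingClass D}

lemma exists_pointedCover_structures (a : BranchingClass D) :
    ∃ 𝒰 : PointedCover X, ∀ x, Nonempty (StructuresWithClass a (𝒰.nhd x)) := by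
  choose U hU hp using exists_local_structure a
  exact ⟨⟨U, hU⟩, hp⟩

lemma exists_cocycle_isDifference {𝒰 : PointedCover X}
    (p : ∀ x, StructuresWithClass a (𝒰.nhd x)) :
    ∃ s : Cocycle D 𝒰, ∀ x y, IsDifference (p x) (p y) (s.1 x y) := by
  choose s hs using fun x y => exists_isDifference (W := 𝒰.nhd x ⊓ 𝒰.nhd y) (p x) (p y)
    inf_le_left inf_le_right
  refine ⟨⟨s, fun x y z => ?_⟩, hs⟩
  -- Both sides of the cocycle relation are the difference from `p x` to `p z` on the triple
  -- intersection.
  exact (((hs x y).res _).add ((hs y z).res _)).unique ((hs x z).res _)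

lemma sub_eq_sub_of_add_eq_add {G : Type*} [AddCommGroup G] (b c d e : G) (h : e + b = c + d) :
    b - c = d - e := by
  rw [sub_eq_sub_iff_add_eq_add, add_comm, h, add_comm]

/-- The class of the difference cocycle does not depend on the local structures. -/
lemma toH1_eq_of_isDifference {𝒰 𝒱 : PointedCover X} {p : ∀ x, StructuresWithClass a (𝒰.nhd x)}
    {p' : ∀ x, StructuresWithClass a (𝒱.nhd x)} {s : Cocycle D 𝒰} {s' : Cocycle D 𝒱}
    (hs : ∀ x y, IsDifference (p x) (p y) (s.1 x y))
    (hs' : ∀ x y, IsDifference (p' x) (p' y) (s'.1 x y)) :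
    Cocycle.toH1 D 𝒰 s = Cocycle.toH1 D 𝒱 s' := by
  obtain ⟨𝒲, h, h'⟩ := exists_ge_ge 𝒰 𝒱
  rw [← Cocycle.toH1_refine h, ← Cocycle.toH1_refine h']
  -- On a common refinement, the cochain of differences from p' to p has coboundary s - s'.
  choose t ht using fun x => exists_isDifference (W := 𝒲.nhd x) (p' x) (p x) (h' x) (h x)
  refine congrArg (Module.DirectLimit.of ℂ (PointedCover X) (CoverH1 D) (CoverH1.refine D) 𝒲)
    ((Submodule.Quotient.eq _).2 ⟨t, Subtype.ext (funext fun x => funext fun y => ?_)⟩)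
  have h1 := (((hs' x y).res (inf_le_inf (h' x) (h' y))).add ((ht y).res inf_le_right)).unique
    (((ht x).res inf_le_left).add ((hs x y).res (inf_le_inf (h x) (h y))))
  show QuadDiff.res D inf_le_right (t y) - QuadDiff.res D inf_le_left (t x) =
    QuadDiff.res D (inf_le_inf (h x) (h y)) (s.1 x y) -
      QuadDiff.res D (inf_le_inf (h' x) (h' y)) (s'.1 x y)
  exact sub_eq_sub_of_add_eq_add (QuadDiff.res D inf_le_right (t y))
    (QuadDiff.res D inf_le_left (t x)) (QuadDiff.res D (inf_le_inf (h x) (h y)) (s.1 x y))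
    (QuadDiff.res D (inf_le_inf (h' x) (h' y)) (s'.1 x y)) h1

lemma zero_eq_neg_neg_add_sub_add_neg {G : Type*} [AddCommGroup G] (b c : G) :
    0 = - -b + (c - b) + -c := by
  abel

/-- A class that is zero in the direct limit is already a coboundary (t_y - t_x) on some finer
cover. Translating each `p x` by -t_x makes the structures agree on overlaps, so their charts
together form a global atlas. -/
lemma exists_global_of_toH1_eq_zero {𝒰 : PointedCover X}
    {p : ∀ x, StructuresWithClass a (𝒰.nhd x)} {s : Cocycle D 𝒰}
    (hs : ∀ x y, IsDifference (p x) (p y) (s.1 x y)) (h0 : Cocycle.toH1 D 𝒰 s = 0) :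
    Nonempty (StructuresWithClass a ⊤) := by
  obtain ⟨𝒱, h, hr⟩ := Module.DirectLimit.of.zero_exact (R := ℂ) (G := CoverH1 D)
    (f := CoverH1.refine D) (x := Submodule.Quotient.mk s) h0
  obtain ⟨t, ht⟩ : Cocycle.refine D h s ∈ LinearMap.range (coboundary D 𝒱) :=
    (Submodule.Quotient.mk_eq_zero _).1 hr
  have hst : ∀ x y, QuadDiff.res D (inf_le_inf (h x) (h y)) (s.1 x y) =
      QuadDiff.res D inf_le_right (t y) - QuadDiff.res D inf_le_left (t x) := fun x y =>
    (congrFun (congrFun (congrArg Subtype.val ht) x) y).symm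
  choose p' hp' using fun x => exists_translate (p x) (h x) (-t x)
  have hd : ∀ x y, IsDifference (p' x) (p' y) (0 : QuadDiff D (𝒱.nhd x ⊓ 𝒱.nhd y)) := by
    intro x y
    have h1 := (((hp' x).res inf_le_left).symm.add
      ((hs x y).res (inf_le_inf (h x) (h y)))).add ((hp' y).res inf_le_right)
    convert h1 using 1
    rw [hst]
    exact zero_eq_neg_neg_add_sub_add_neg (QuadDiff.res D inf_le_left (t x))
      (QuadDiff.res D inf_le_right (t y))
  have hA : IsBranchedAtlas ⊤ {c | ∃ x, (p' x).1.IsChart c} := by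
    refine ⟨fun _ _ => le_top, fun x _ => ?_, ?_⟩
    · obtain ⟨c, hc, hxc⟩ := (p' x).1.exists_isChart (𝒱.mem x)
      exact ⟨c, ⟨x, hc⟩, hxc⟩
    · rintro c ⟨x, hc⟩ c' ⟨y, hc'⟩ z hz hz'
      exact (hd x y).compatible hc hc' ⟨hc.le hz, hc'.le hz'⟩ hz hz'
  obtain ⟨P, -⟩ := exists_structure hA fun c ⟨x, hc⟩ z hz => (p' x).hasOrbit hc hz
  exact ⟨P⟩

lemma toH1_eq_zero_of_global (P : StructuresWithClass a ⊤) {𝒰 : PointedCover X}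
    {p : ∀ x, StructuresWithClass a (𝒰.nhd x)} {s : Cocycle D 𝒰}
    (hs : ∀ x y, IsDifference (p x) (p y) (s.1 x y)) : Cocycle.toH1 D 𝒰 s = 0 := by
  -- The class may be computed from any cover and any local structures; the constant choice P has
  -- difference cocycle zero.
  let 𝒱 : PointedCover X := ⟨fun _ => ⊤, fun _ => trivial⟩
  rw [toH1_eq_of_isDifference (𝒱 := 𝒱) (p' := fun _ => P) (s' := 0) hs
    (fun _ _ => .refl P le_top), map_zero]

/-- The structures with a given branching class form an affine space. -/
lemma exists_addTorsor (a : BranchingClass D) (h : Nonempty (StructuresWithClass a ⊤)) :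
    ∃ _ : AddTorsor (H0 D) (StructuresWithClass a ⊤),
      ∀ p₁ p₂ : StructuresWithClass a ⊤, IsDifference p₁ p₂ (p₂ -ᵥ p₁) := by
  choose tr htr using fun (q : H0 D) (p : StructuresWithClass a ⊤) =>
    exists_translate p le_rfl q
  choose df hdf using fun p₁ p₂ : StructuresWithClass a ⊤ =>
    exists_isDifference (W := ⊤) p₁ p₂ le_rfl le_rfl
  -- A structure is determined by its difference from p. Together with uniqueness of differences,
  -- this gives every torsor axiom from the additivity of differences.
  have huniq : ∀ {p p₁ p₂ : StructuresWithClass a ⊤} {q : H0 D}, IsDifference p p₁ q →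
      IsDifference p p₂ q → p₁ = p₂ := by
    intro p p₁ p₂ q h1 h2
    have : IsDifference p₁ p₂ (0 : H0 D) := by
      convert h1.symm.add h2 using 1
      exact (neg_add_cancel q).symm
    exact this.eq
  exact ⟨{ vadd := tr
           zero_vadd := fun p => huniq (htr 0 p) (.refl p le_rfl)
           add_vadd := fun q r p => huniq (htr (q + r) p) (by
             rw [add_comm]
             exact (htr r p).add (htr q (tr r p)))
           vsub := fun p₂ p₁ => df p₁ p₂
           nonempty := h
           vsub_vadd' := fun p₁ p₂ => huniq (htr _ p₂) (hdf p₂ p₁)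
           vadd_vsub' := fun q p => (hdf p (tr q p)).unique (htr q p) }, hdf⟩

end Obstruction

end BranchedProj

open BranchedProj
theorem mainTheorem9 {X : Type*} [TopologicalSpace X] [T2Space X] [ChartedSpace ℂ X]
    [IsManifold 𝓘(ℂ, ℂ) ω X] (D : EffectiveDivisor X) (a : BranchingClass D) :
    (∃ c : H1 D,
      (∃ 𝒰 : PointedCover X, ∀ x, Nonempty (StructuresWithClass a (𝒰.nhd x))) ∧
      (∀ (𝒰 : PointedCover X) (p : ∀ x, StructuresWithClass a (𝒰.nhd x)),
        ∃ s : Cocycle D 𝒰, (∀ x y, IsDifference (p x) (p y) (s.1 x y)) ∧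
          Cocycle.toH1 D 𝒰 s = c) ∧
      (c = 0 ↔ Nonempty (StructuresWithClass a ⊤))) ∧
    (Nonempty (StructuresWithClass a ⊤) →
      ∃ _ : AddTorsor (H0 D) (StructuresWithClass a ⊤),
        ∀ p₁ p₂ : StructuresWithClass a ⊤, IsDifference p₁ p₂ (p₂ -ᵥ p₁)) := by
  obtain ⟨𝒰, h𝒰⟩ := exists_pointedCover_structures a
  obtain ⟨s, hs⟩ := exists_cocycle_isDifference fun x => (h𝒰 x).some
  refine ⟨⟨Cocycle.toH1 D 𝒰 s, ⟨𝒰, h𝒰⟩, fun 𝒱 p => ?_, exists_global_of_toH1_eq_zero hs,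
    fun ⟨P⟩ => toH1_eq_zero_of_global P hs⟩, exists_addTorsor a⟩
  obtain ⟨s', hs'⟩ := exists_cocycle_isDifference p
  exact ⟨s', hs', toH1_eq_of_isDifference hs' hs⟩
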